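/- Let $n\ge 1$ be an integer and let $p$ be a real number with $\frac{n}{n+2}<p<2$. For a real symmetric positive definite $n\times n$ matrix $D$ and $u\in\mathbb R^n$ let $f_p(D,u,\cdot)$ be the $p$-Gaussian density on $\mathbb R^n$: for $p\neq 1$ $$f_p(D,u,z)=A_{n,p}\sqrt{\det D}\,\Bigl(1+\tfrac{1-p}{2p-n(1-p)}\langle z-u,D(z-u)\rangle\Bigr)^{\frac1{p-1}}$$ for all $z\in\mathbb R^n$ if $p<1$, and, if $p>1$, for those $z$ for which the expression in the large brackets is nonnegative, with $f_p(D,u,z)=0$ for all other $z$; here $$A_{n,p}=\Bigl(\tfrac{1-p}{2p-n(1-p)}\Bigr)^{n/2}\frac{\Gamma\bigl(\frac1{1-p}\bigr)}{\pi^{n/2}\,\Gamma\bigl(\frac1{1-p}-\frac n2\bigr)}\ \ (p<1),\qquad A_{n,p}=\Bigl(\tfrac{p-1}{2p-n(1-p)}\Bigr)^{n/2}\frac{\Gamma\bigl(\frac p{p-1}+\frac n2\bigr)}{\pi^{n/2}\,\Gamma\bigl(\frac p{p-1}\bigr)}\ \ (p>1);$$ for $p=1$, $f_1(D,u,z)=\sqrt{\det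 D}\,(2\pi)^{-n/2}\exp\bigl(-\tfrac12\langle z-u,D(z-u)\rangle\bigr)$. For a real symmetric $n\times n$ matrix $X$ and $x\in\mathbb R^n$ write $\frac{\partial h(D,u)}{\partial(X,x)}=\frac{d}{dt}h(D+tX,u+tx)\big|_{t=0}$. Then for every such $D$ and $u$, all real symmetric $n\times n$ matrices $X,Y$ and all $x,y\in\mathbb R^n$, the derivatives of $\log f_p(D,u,z)$ along $(X,x)$ and $(Y,y)$ exist at every $z$ with $f_p(D,u,z)>0$, the integral defining the Fisher information $$g^{(F,p)}_{D,u}\bigl((X,x),(Y,y)\bigr)=\int_{\mathbb R^n}f_p(D,u,z)\,\frac{\partial\log f_p(D,u,z)}{\partial(X,x)}\,\frac{\partial\log f_p(D,u,z)}{\partial(Y,y)}\,dz$$ (with the integrand taken to be $0$ where $f_p(D,u,z)=0$) converges absolutely, and $$g^{(F,p)}_{D,u}\bigl((X,x),(Y,y)\bigr)=\frac{1}{2(2-p)}\operatorname{Tr}\bigl(D^{-1}XD^{-1}Y\bigr)+\frac{p-1}{4(2-p)}\operatorname{Tr}\bigl(D^{-1}X\bigr)\operatorname{Tr}\bigl(D^{-1}Y\bigr)+\frac{2+n(p-1)}{(2p+n(p-1))(2-p)}\langle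 x,Dy\rangle .$$ -/

import Mathlib

open scoped Matrix

noncomputable section

namespace PGaussian

/-- The label set: pairs `(n, p)` with `n > 0` and `p > n / (n + 2)`. -/
def labelSet : Set (ℕ × ℝ) :=
  {np | 0 < np.1 ∧ (np.1 : ℝ) / ((np.1 : ℝ) + 2) < np.2}

/-- The quadratic form `⟨z - u, D (z - u)⟩`. -/
def quad {n : ℕ} (D : Matrix (Fin n) (Fin n) ℝ) (u z : Fin n → ℝ) : ℝ :=
  (z - u) ⬝ᵥ (D *ᵥ (z - u))

/-- The base `1 + (1 - p) / (2 p - n (1 - p)) ⟨z - u, D (z - u)⟩` of the power in the density. -/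
def base {n : ℕ} (p : ℝ) (D : Matrix (Fin n) (Fin n) ℝ) (u z : Fin n → ℝ) : ℝ :=
  1 + (1 - p) / (2 * p - (n : ℝ) * (1 - p)) * quad D u z

/-- The domain of the density: the ellipsoid where `base` is nonnegative if `p > 1`,
and the whole space otherwise. -/
def dom {n : ℕ} (p : ℝ) (D : Matrix (Fin n) (Fin n) ℝ) (u : Fin n → ℝ) : Set (Fin n → ℝ) :=
  {z | 1 < p → 0 ≤ base p D u z}

/-- The normalization constant `A_{n,p}` (only used for `p ≠ 1`). -/
def normConst (n : ℕ) (p : ℝ) : ℝ :=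
  if p < 1 then
    ((1 - p) / (2 * p - (n : ℝ) * (1 - p))) ^ ((n : ℝ) / 2) *
      (Real.Gamma (1 / (1 - p)) /
        (Real.pi ^ ((n : ℝ) / 2) * Real.Gamma (1 / (1 - p) - (n : ℝ) / 2)))
  else
    ((p - 1) / (2 * p - (n : ℝ) * (1 - p))) ^ ((n : ℝ) / 2) *
      (Real.Gamma (p / (p - 1) + (n : ℝ) / 2) /
        (Real.pi ^ ((n : ℝ) / 2) * Real.Gamma (p / (p - 1))))

open Classical in
/-- The density `f_p(D, u, ·)` of the `p`-Gaussian distribution; for `p = 1` it is the usual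
Gaussian density with mean `u` and inverse covariance matrix `D`. -/
def density {n : ℕ} (p : ℝ) (D : Matrix (Fin n) (Fin n) ℝ) (u z : Fin n → ℝ) : ℝ :=
  if p = 1 then
    Real.sqrt D.det / Real.sqrt ((2 * Real.pi) ^ n) * Real.exp (-(1 / 2) * quad D u z)
  else if z ∈ dom p D u then
    normConst n p * Real.sqrt D.det * base p D u z ^ (1 / (p - 1))
  else 0

/-- The restriction `t ↦ h (D + t X, u + t x)` of a function `h` of the parameter `(D, u)` to the
line through `(D, u)` in the direction of the tangent vector `(X, x)`. -/
def alongLine {n : ℕ} (h : Matrix (Fin n) (Fin n) ℝ → (Fin n → ℝ) → ℝ)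
    (D : Matrix (Fin n) (Fin n) ℝ) (u : Fin n → ℝ)
    (X : Matrix (Fin n) (Fin n) ℝ) (x : Fin n → ℝ) (t : ℝ) : ℝ :=
  h (D + t • X) (u + t • x)

/-- The derivative of `h` at the parameter `(D, u)` along the tangent vector `(X, x)`. -/
def tangentDeriv {n : ℕ} (h : Matrix (Fin n) (Fin n) ℝ → (Fin n → ℝ) → ℝ)
    (D : Matrix (Fin n) (Fin n) ℝ) (u : Fin n → ℝ)
    (X : Matrix (Fin n) (Fin n) ℝ) (x : Fin n → ℝ) : ℝ :=
  deriv (alongLine h D u X x) 0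

/-- The integrand of the Fisher information of a family `f (D, u, ·)` of densities:
`f` times the product of the derivatives of `log f` along `(X, x)` and `(Y, y)`.
Where the density vanishes, the factor `f` makes the integrand zero. -/
def fisherIntegrand {n : ℕ}
    (f : Matrix (Fin n) (Fin n) ℝ → (Fin n → ℝ) → (Fin n → ℝ) → ℝ)
    (D : Matrix (Fin n) (Fin n) ℝ) (u : Fin n → ℝ)
    (X : Matrix (Fin n) (Fin n) ℝ) (x : Fin n → ℝ)
    (Y : Matrix (Fin n) (Fin n) ℝ) (y : Fin n → ℝ) (z : Fin n → ℝ) : ℝ :=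
  f D u z * tangentDeriv (fun D' u' => Real.log (f D' u' z)) D u X x *
    tangentDeriv (fun D' u' => Real.log (f D' u' z)) D u Y y

/-- The Fisher information at `(D, u)` evaluated at the tangent vectors `(X, x)`, `(Y, y)`;
the integral is with respect to Lebesgue measure on `ℝⁿ`. -/
def fisherInformation {n : ℕ}
    (f : Matrix (Fin n) (Fin n) ℝ → (Fin n → ℝ) → (Fin n → ℝ) → ℝ)
    (D : Matrix (Fin n) (Fin n) ℝ) (u : Fin n → ℝ)
    (X : Matrix (Fin n) (Fin n) ℝ) (x : Fin n → ℝ)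
    (Y : Matrix (Fin n) (Fin n) ℝ) (y : Fin n → ℝ) : ℝ :=
  ∫ z : Fin n → ℝ, fisherIntegrand f D u X x Y y z

end PGaussian

end

/-! Put `w = z - u` and let `m = 2p - n(1-p)`, which is positive exactly because `p > n/(n+2)`.
Along `(X, x)` the score is `½ Tr(D⁻¹X) - (⟨w, Xw⟩ - 2⟨Dx, w⟩) / (m · base)`, also for `p = 1`,
where `m = 2` and `base = 1`. The Fisher integrand is therefore a sum of homogeneous polynomials in
`w` times `f_p / base^j` with `j ≤ 2` (`fisherIntegrand_eq`).

A moment of degree `d` against `f_p / base^j` is a Gaussian moment times a constant depending only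
on `n, p, d, j` (`Homog.integral_mul_weight`). For `p < 1` the weight is a Gamma mixture of
Gaussians; for `p > 1`, conversely, the Gaussian is a mixture of dilated compactly supported
weights. Fubini and the scaling of homogeneous functions then give Gamma quotients. The bound `p <
2` makes `f_p / base²` integrable at the boundary of the ellipsoid when `p > 1`.

Gaussian moments up to degree four come from integration by parts, and odd ones vanish. The
quotients for `(d, j) = (0,0), (2,1), (4,2), (2,2)` simplify by `Γ(s+1) = s Γ(s)`, which produces
the factors `2 - p` and `2 + n(p-1)`. -/

noncomputable section

open MeasureTheory Real

namespace PGaussian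

/-! ### Homogeneous functions against a Gaussian: integrability and scaling -/

section Homogeneous

/-- Continuous functions on `ℝⁿ` that are positively homogeneous of degree `d`. -/
structure Homog {n : ℕ} (d : ℕ) (h : (Fin n → ℝ) → ℝ) : Prop where
  cont : Continuous h
  smul : ∀ t : ℝ, 0 < t → ∀ w, h (t • w) = t ^ d * h w

namespace Homog

variable {n d e : ℕ} {h k : (Fin n → ℝ) → ℝ}

lemma const (c : ℝ) : Homog (n := n) 0 (fun _ => c) := ⟨continuous_const, by simp⟩

lemma mul (hh : Homog d h) (hk : Homog e k) : Homog (d + e) (fun w => h w * k w) :=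
  ⟨hh.cont.mul hk.cont, fun t ht w => by simp only [hh.smul t ht, hk.smul t ht]; ring⟩

lemma abs (hh : Homog d h) : Homog d (fun w => |h w|) :=
  ⟨hh.cont.abs, fun t ht w => by
    simp only [hh.smul t ht, abs_mul, abs_of_pos (pow_pos ht d)]⟩

lemma add (hh : Homog d h) (hk : Homog d k) : Homog d (fun w => h w + k w) :=
  ⟨hh.cont.add hk.cont, fun t ht w => by simp only [hh.smul t ht, hk.smul t ht]; ring⟩

lemma linear (v : Fin n → ℝ) : Homog 1 (fun w => v ⬝ᵥ w) :=
  ⟨by fun_prop, fun t _ w => by simp⟩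

lemma quadratic (M : Matrix (Fin n) (Fin n) ℝ) : Homog 2 (fun w => w ⬝ᵥ (M *ᵥ w)) :=
  ⟨by fun_prop, fun t _ w => by simp [Matrix.mulVec_smul]; ring⟩

/-- Compactness bounds `h` on the unit ball. Dividing by `1 + ‖w‖` instead of `‖w‖` lands in the
ball and avoids a separate case at the origin. -/
lemma exists_bound (hh : Homog d h) : ∃ C, 0 ≤ C ∧ ∀ w, |h w| ≤ C * (1 + ‖w‖) ^ d := by
  obtain ⟨C, hC⟩ := (isCompact_closedBall (0 : Fin n → ℝ) 1).exists_bound_of_continuousOn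
    hh.cont.continuousOn
  have h0 : 0 ≤ C := (norm_nonneg _).trans (hC 0 (by simp))
  refine ⟨C, h0, fun w => ?_⟩
  have hpos : 0 < 1 + ‖w‖ := by positivity
  have hw : w = (1 + ‖w‖) • ((1 + ‖w‖)⁻¹ • w) := by
    rw [smul_smul, mul_inv_cancel₀ hpos.ne', one_smul]
  have hb := hC ((1 + ‖w‖)⁻¹ • w) (by
    rw [mem_closedBall_zero_iff, norm_smul, Real.norm_of_nonneg (by positivity),
      inv_mul_le_iff₀ hpos]
    linarith)
  rw [hw, hh.smul _ hpos, abs_mul, abs_of_pos (pow_pos hpos d), mul_comm, ← hw]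
  exact mul_le_mul_of_nonneg_right hb (by positivity)

end Homog

variable {n d : ℕ}

lemma exists_mul_norm_sq_le {D : Matrix (Fin n) (Fin n) ℝ} (hD : D.PosDef) :
    ∃ ε, 0 < ε ∧ ∀ w : Fin n → ℝ, ε * ‖w‖ ^ 2 ≤ w ⬝ᵥ (D *ᵥ w) := by
  have hq := Homog.quadratic D
  have key : ∃ ε, 0 < ε ∧ ∀ w ∈ Metric.sphere (0 : Fin n → ℝ) 1, ε ≤ w ⬝ᵥ (D *ᵥ w) := by
    -- The unit sphere is empty when `n = 0`.
    rcases (Metric.sphere (0 : Fin n → ℝ) 1).eq_empty_or_nonempty with he | hne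
    · exact ⟨1, one_pos, by simp [he]⟩
    · obtain ⟨v, hv, hmin⟩ := (isCompact_sphere (0 : Fin n → ℝ) 1).exists_isMinOn hne
        hq.cont.continuousOn
      refine ⟨_, ?_, fun w hw => hmin hw⟩
      have : v ≠ 0 := by rintro rfl; simp at hv
      simpa using hD.dotProduct_mulVec_pos this
  obtain ⟨ε, hε, H⟩ := key
  refine ⟨ε, hε, fun w => ?_⟩
  rcases eq_or_ne w 0 with rfl | hw
  · simp
  have hpos : 0 < ‖w‖ := norm_pos_iff.2 hw
  have hw' : w = ‖w‖ • (‖w‖⁻¹ • w) := by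
    rw [smul_smul, mul_inv_cancel₀ hpos.ne', one_smul]
  have h1 := H (‖w‖⁻¹ • w) (by simp [norm_smul, hpos.ne'])
  have h2 := hq.smul _ hpos (‖w‖⁻¹ • w)
  rw [← hw'] at h2
  rw [h2, mul_comm]
  exact mul_le_mul_of_nonneg_left h1 (by positivity)

/-- The power is absorbed by `exp (1 + r)`, and completing the square gives `r - ε r² ≤ 1 / (4ε)`.
-/
lemma one_add_pow_mul_exp_le (N : ℕ) {ε r : ℝ} (hε : 0 < ε) (hr : 0 ≤ r) :
    (1 + r) ^ N * exp (-(ε * r ^ 2)) ≤ N.factorial * exp (1 + 1 / (4 * ε)) := by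
  have h1 := Real.pow_div_factorial_le_exp (1 + r) (by positivity) N
  rw [div_le_iff₀ (by positivity)] at h1
  have h2 : exp (1 + r) * exp (-(ε * r ^ 2)) ≤ exp (1 + 1 / (4 * ε)) := by
    rw [← Real.exp_add, Real.exp_le_exp]
    have : 1 / (4 * ε) - r + ε * r ^ 2 = ε * (r - 1 / (2 * ε)) ^ 2 := by field_simp; ring
    nlinarith [mul_nonneg hε.le (sq_nonneg (r - 1 / (2 * ε)))]
  calc (1 + r) ^ N * exp (-(ε * r ^ 2))
      ≤ exp (1 + r) * N.factorial * exp (-(ε * r ^ 2)) := by gcongr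
    _ = N.factorial * (exp (1 + r) * exp (-(ε * r ^ 2))) := by ring
    _ ≤ _ := by gcongr

/-- The integrand is dominated by a multiple of `(1 + ‖w‖) ^ (-(n + 1))`, whose exponent exceeds the
dimension. -/
lemma Homog.integrable_mul_exp {h : (Fin n → ℝ) → ℝ} (hh : Homog d h)
    {D : Matrix (Fin n) (Fin n) ℝ} (hD : D.PosDef) {τ : ℝ} (hτ : 0 < τ) :
    Integrable (fun w => h w * exp (-(τ * (w ⬝ᵥ (D *ᵥ w))))) := by
  obtain ⟨C, hC0, hC⟩ := hh.exists_bound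
  obtain ⟨ε, hε, hQ⟩ := exists_mul_norm_sq_le hD
  have hint := (integrable_one_add_norm (E := Fin n → ℝ) (μ := volume) (r := (n + 1 : ℕ))
    (by simp)).const_mul (C * ((d + (n + 1)).factorial * exp (1 + 1 / (4 * (τ * ε)))))
  refine hint.mono' ?_ (ae_of_all _ fun w => ?_)
  · exact (hh.cont.mul (Real.continuous_exp.comp
      ((Homog.quadratic D).cont.const_mul τ).neg)).aestronglyMeasurable
  · have hpos : 0 < 1 + ‖w‖ := by positivity
    have h1 := one_add_pow_mul_exp_le (d + (n + 1)) (mul_pos hτ hε) (norm_nonneg w)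
    rw [norm_mul, Real.norm_eq_abs, Real.norm_of_nonneg (Real.exp_pos _).le,
      Real.rpow_neg hpos.le, Real.rpow_natCast, ← div_eq_mul_inv, le_div_iff₀ (by positivity)]
    calc |h w| * exp (-(τ * (w ⬝ᵥ (D *ᵥ w)))) * (1 + ‖w‖) ^ (n + 1)
        ≤ (C * (1 + ‖w‖) ^ d) * exp (-(τ * ε * ‖w‖ ^ 2)) * (1 + ‖w‖) ^ (n + 1) := by
          have h2 := mul_le_mul_of_nonneg_left (hQ w) hτ.le
          rw [← mul_assoc] at h2
          gcongr
          exact hC w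
      _ = C * ((1 + ‖w‖) ^ (d + (n + 1)) * exp (-(τ * ε * ‖w‖ ^ 2))) := by ring
      _ ≤ _ := by gcongr

/-- The unnormalized Gaussian moment `∫ h(w) exp(-⟨w, D w⟩ / 2) dw`. -/
def gaussMoment (D : Matrix (Fin n) (Fin n) ℝ) (h : (Fin n → ℝ) → ℝ) : ℝ :=
  ∫ w, h w * exp (-(1 / 2 * (w ⬝ᵥ (D *ᵥ w))))

/-- Substitute `√(2τ) w`: the Jacobian contributes `n / 2` to the exponent and homogeneity
contributes `d / 2`. -/
lemma Homog.integral_mul_exp {h : (Fin n → ℝ) → ℝ} (hh : Homog d h)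
    (D : Matrix (Fin n) (Fin n) ℝ) {τ : ℝ} (hτ : 0 < τ) :
    ∫ w, h w * exp (-(τ * (w ⬝ᵥ (D *ᵥ w)))) =
      (2 * τ) ^ (-(((n : ℝ) + d) / 2)) * gaussMoment D h := by
  have hR : 0 < √(2 * τ) := by positivity
  have hR2 : √(2 * τ) ^ 2 = 2 * τ := Real.sq_sqrt (by positivity)
  have h1 := Measure.integral_comp_smul (volume : Measure (Fin n → ℝ))
    (fun w => h w * exp (-(1 / 2 * (w ⬝ᵥ (D *ᵥ w))))) √(2 * τ)
  have h2 : ∀ w : Fin n → ℝ, h (√(2 * τ) • w) *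
      exp (-(1 / 2 * ((√(2 * τ) • w) ⬝ᵥ (D *ᵥ (√(2 * τ) • w))))) =
      √(2 * τ) ^ d * (h w * exp (-(τ * (w ⬝ᵥ (D *ᵥ w))))) := by
    intro w
    have h3 := (Homog.quadratic D).smul _ hR w
    rw [h3, hh.smul _ hR, hR2, mul_assoc]
    ring_nf
  simp only [h2, integral_const_mul, Module.finrank_fin_fun, smul_eq_mul] at h1
  rw [abs_of_pos (by positivity)] at h1
  have h4 : (2 * τ) ^ (-(((n : ℝ) + d) / 2)) = (√(2 * τ) ^ d)⁻¹ * (√(2 * τ) ^ n)⁻¹ := by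
    rw [Real.sqrt_eq_rpow, ← Real.rpow_natCast, ← Real.rpow_natCast, ← Real.rpow_mul (by positivity),
      ← Real.rpow_mul (by positivity), ← Real.rpow_neg (by positivity),
      ← Real.rpow_neg (by positivity), ← Real.rpow_add (by positivity)]
    congr 1; ring
  rw [h4, gaussMoment, mul_assoc, ← h1, inv_mul_cancel_left₀ (by positivity)]

end Homogeneous

/-! ### Mixture representations of the weights for `p < 1` and `p > 1` -/

section Mixture

variable {n d : ℕ} {h : (Fin n → ℝ) → ℝ}

lemma PosDef.quadratic_nonneg {D : Matrix (Fin n) (Fin n) ℝ} (hD : D.PosDef) (w : Fin n → ℝ) :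
    0 ≤ w ⬝ᵥ (D *ᵥ w) := by
  simpa using hD.posSemidef.dotProduct_mulVec_nonneg w

/-- A nonintegrable function has integral `0` by convention, so the positive Gamma value already
forces integrability. -/
lemma integrableOn_rpow_mul_exp_neg {a r : ℝ} (ha : 0 < a) (hr : 0 < r) :
    IntegrableOn (fun t : ℝ => t ^ (a - 1) * exp (-(r * t))) (Set.Ioi 0) := by
  have := Real.Gamma_pos_of_pos ha
  refine .of_integral_ne_zero ?_
  rw [integral_rpow_mul_exp_neg_mul_Ioi ha hr]
  positivity

lemma Homog.integral_laplace_kernel (hh : Homog d h) (D : Matrix (Fin n) (Fin n) ℝ)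
    {c : ℝ} (hc : 0 < c) (b : ℝ) {t : ℝ} (ht : 0 < t) :
    ∫ w, h w * (t ^ (b - 1) * exp (-((1 + c * (w ⬝ᵥ (D *ᵥ w))) * t))) =
      t ^ (b - ((n : ℝ) + d) / 2 - 1) * exp (-(1 * t)) *
        ((2 * c) ^ (-(((n : ℝ) + d) / 2)) * gaussMoment D h) := by
  have h1 : ∀ w : Fin n → ℝ, h w * (t ^ (b - 1) * exp (-((1 + c * (w ⬝ᵥ (D *ᵥ w))) * t))) =
      (t ^ (b - 1) * exp (-(1 * t))) * (h w * exp (-(t * c * (w ⬝ᵥ (D *ᵥ w))))) := by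
    intro w
    rw [show -((1 + c * (w ⬝ᵥ (D *ᵥ w))) * t) =
      -(1 * t) + -(t * c * (w ⬝ᵥ (D *ᵥ w))) by ring, Real.exp_add]
    ring
  simp only [h1, integral_const_mul]
  rw [hh.integral_mul_exp D (mul_pos ht hc), show 2 * (t * c) = t * (2 * c) by ring,
    Real.mul_rpow ht.le (by positivity), show b - ((n : ℝ) + d) / 2 - 1 =
      (b - 1) + -(((n : ℝ) + d) / 2) by ring, Real.rpow_add ht]
  ring

/-- Moments of the heavy-tailed weight `(1 + c ⟨w, D w⟩) ^ (-b)` in terms of Gaussian ones. -/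
lemma Homog.integral_mul_one_add_rpow (hh : Homog d h) {D : Matrix (Fin n) (Fin n) ℝ}
    (hD : D.PosDef) {b c : ℝ} (hc : 0 < c) (hb : ((n : ℝ) + d) / 2 < b) :
    Integrable (fun w => h w * (1 + c * (w ⬝ᵥ (D *ᵥ w))) ^ (-b)) ∧
    ∫ w, h w * (1 + c * (w ⬝ᵥ (D *ᵥ w))) ^ (-b) =
      Gamma (b - ((n : ℝ) + d) / 2) / Gamma b *
        ((2 * c) ^ (-(((n : ℝ) + d) / 2)) * gaussMoment D h) := by
  have hb0 : 0 < b := lt_of_le_of_lt (by positivity) hb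
  have hbd : 0 < b - ((n : ℝ) + d) / 2 := by linarith
  have hΓ := Real.Gamma_pos_of_pos hb0
  have hQ := PosDef.quadratic_nonneg hD
  -- Integrating over `t > 0` gives `Γ(b) h(w) (1 + c⟨w, Dw⟩)^(-b)`; for fixed `t` the function of
  -- `w` is Gaussian.
  set F : (Fin n → ℝ) → ℝ → ℝ := fun w t =>
    h w * (t ^ (b - 1) * exp (-((1 + c * (w ⬝ᵥ (D *ᵥ w))) * t))) with hF
  have hmeas : Measurable (Function.uncurry F) := by
    have h1 := hh.cont.measurable
    have h2 := (Homog.quadratic D).cont.measurable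
    simp only [hF, Function.uncurry_def]
    fun_prop
  have hint : Integrable (Function.uncurry F) (volume.prod (volume.restrict (Set.Ioi 0))) := by
    rw [integrable_prod_iff' hmeas.aestronglyMeasurable]
    constructor
    · filter_upwards [ae_restrict_mem measurableSet_Ioi] with t ht
      have ht : 0 < t := ht
      refine ((hh.integrable_mul_exp hD (mul_pos ht hc)).const_mul
        (t ^ (b - 1) * exp (-(1 * t)))).congr (ae_of_all _ fun w => ?_)
      simp only [hF, Function.uncurry]
      rw [show -((1 + c * (w ⬝ᵥ (D *ᵥ w))) * t) =
        -(1 * t) + -(t * c * (w ⬝ᵥ (D *ᵥ w))) by ring, Real.exp_add]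
      ring
    -- The norm integral is the same kernel for `|h|`, homogeneous of the same degree; it converges
    -- at `t = 0` because `b > (n + d) / 2`.
    · refine ((integrableOn_rpow_mul_exp_neg hbd one_pos).mul_const
        ((2 * c) ^ (-(((n : ℝ) + d) / 2)) * gaussMoment D (fun w => |h w|))).congr ?_
      filter_upwards [ae_restrict_mem measurableSet_Ioi] with t ht
      have ht : 0 < t := ht
      rw [← hh.abs.integral_laplace_kernel D hc b ht]
      refine integral_congr_ae (ae_of_all _ fun w => ?_)
      simp only [hF, Function.uncurry, norm_mul, Real.norm_eq_abs, Real.abs_exp,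
        abs_of_pos (Real.rpow_pos_of_pos ht _)]
  have hin : ∀ w, ∫ t in Set.Ioi (0 : ℝ), F w t =
      Gamma b * (h w * (1 + c * (w ⬝ᵥ (D *ᵥ w))) ^ (-b)) := by
    intro w
    have hpos : 0 < 1 + c * (w ⬝ᵥ (D *ᵥ w)) := by
      have := mul_nonneg hc.le (hQ w); linarith
    simp only [hF, integral_const_mul]
    rw [integral_rpow_mul_exp_neg_mul_Ioi hb0 hpos, one_div, Real.inv_rpow hpos.le,
      Real.rpow_neg hpos.le]
    ring
  have h1 := hint.integral_prod_left
  have h2 := integral_integral_swap hint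
  simp only [Function.uncurry, hin] at h1 h2
  refine ⟨?_, ?_⟩
  · exact (integrable_const_mul_iff hΓ.ne'.isUnit _).1 h1
  · rw [integral_const_mul, setIntegral_congr_fun measurableSet_Ioi
      (fun t ht => hh.integral_laplace_kernel D hc b ht), integral_mul_const,
      integral_rpow_mul_exp_neg_mul_Ioi hbd one_pos] at h2
    rw [div_mul_eq_mul_div, eq_div_iff hΓ.ne', mul_comm, h2]
    simp

/-- The power `s ^ a` for `s > 0`, extended by zero. -/
def posPow (a s : ℝ) : ℝ := if 0 < s then s ^ a else 0

lemma posPow_of_pos {a s : ℝ} (hs : 0 < s) : posPow a s = s ^ a := if_pos hs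

lemma posPow_of_nonpos {a s : ℝ} (hs : s ≤ 0) : posPow a s = 0 := if_neg hs.not_gt

lemma posPow_nonneg (a s : ℝ) : 0 ≤ posPow a s := by
  unfold posPow; split_ifs <;> positivity

lemma measurable_posPow (a : ℝ) : Measurable (posPow a) :=
  Measurable.ite measurableSet_Ioi (by fun_prop) measurable_const

lemma posPow_mul {a s t : ℝ} (ht : 0 < t) : posPow a (t * s) = t ^ a * posPow a s := by
  rcases lt_or_ge 0 s with hs | hs
  · rw [posPow_of_pos hs, posPow_of_pos (mul_pos ht hs), Real.mul_rpow ht.le hs.le]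
  · rw [posPow_of_nonpos hs, posPow_of_nonpos (mul_nonpos_of_nonneg_of_nonpos ht.le hs), mul_zero]

lemma posPow_mul_exp_eq_indicator (a : ℝ) : (fun s => posPow a s * exp (-s)) =
    (Set.Ioi 0).indicator (fun s : ℝ => s ^ (a + 1 - 1) * exp (-(1 * s))) := by
  ext s
  by_cases hs : 0 < s
  · rw [Set.indicator_of_mem (by exact hs), posPow_of_pos hs]; simp
  · rw [Set.indicator_of_notMem (by exact hs), posPow_of_nonpos (not_lt.1 hs), zero_mul]

lemma integrable_posPow_mul_exp {a : ℝ} (ha : -1 < a) :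
    Integrable (fun s => posPow a s * exp (-s)) := by
  rw [posPow_mul_exp_eq_indicator, integrable_indicator_iff measurableSet_Ioi]
  exact integrableOn_rpow_mul_exp_neg (by linarith) one_pos

lemma integral_posPow_mul_exp {a : ℝ} (ha : -1 < a) :
    ∫ s, posPow a s * exp (-s) = Gamma (a + 1) := by
  rw [posPow_mul_exp_eq_indicator, integral_indicator measurableSet_Ioi,
    integral_rpow_mul_exp_neg_mul_Ioi (by linarith) one_pos]
  simp

lemma posPow_sub_mul_exp_eq (a q s : ℝ) : posPow a (s - q) * exp (-s) =
    exp (-q) * (posPow a (s - q) * exp (-(s - q))) := by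
  rw [mul_left_comm, ← Real.exp_add]; congr 2; ring

lemma integrable_posPow_sub_mul_exp {a : ℝ} (ha : -1 < a) (q : ℝ) :
    Integrable (fun s => posPow a (s - q) * exp (-s)) := by
  simp only [posPow_sub_mul_exp_eq]
  exact ((integrable_posPow_mul_exp ha).comp_sub_right q).const_mul _

lemma integral_posPow_sub_mul_exp {a : ℝ} (ha : -1 < a) (q : ℝ) :
    ∫ s, posPow a (s - q) * exp (-s) = exp (-q) * Gamma (a + 1) := by
  simp only [posPow_sub_mul_exp_eq]
  rw [integral_const_mul, integral_sub_right_eq_self (fun s => posPow a s * exp (-s)),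
    integral_posPow_mul_exp ha]

lemma Homog.mul_posPow_smul (hh : Homog d h) (D : Matrix (Fin n) (Fin n) ℝ) (a k : ℝ)
    {s : ℝ} (hs : 0 < s) (w : Fin n → ℝ) :
    h (√s • w) * posPow a (s - k * ((√s • w) ⬝ᵥ (D *ᵥ (√s • w)))) =
      √s ^ d * s ^ a * (h w * posPow a (1 - k * (w ⬝ᵥ (D *ᵥ w)))) := by
  have hR : 0 < √s := Real.sqrt_pos.2 hs
  have h3 := (Homog.quadratic D).smul _ hR w
  rw [h3, hh.smul _ hR, Real.sq_sqrt hs.le, show s - k * (s * (w ⬝ᵥ (D *ᵥ w))) =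
    s * (1 - k * (w ⬝ᵥ (D *ᵥ w))) by ring, posPow_mul hs]
  ring

lemma Homog.integral_mul_posPow_sub (hh : Homog d h) (D : Matrix (Fin n) (Fin n) ℝ) (a k s : ℝ)
    (hs : 0 < s) :
    ∫ w, h w * posPow a (s - k * (w ⬝ᵥ (D *ᵥ w))) =
      s ^ (a + ((n : ℝ) + d) / 2) * ∫ w, h w * posPow a (1 - k * (w ⬝ᵥ (D *ᵥ w))) := by
  have hR : 0 < √s := Real.sqrt_pos.2 hs
  have h1 := Measure.integral_comp_smul (volume : Measure (Fin n → ℝ))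
    (fun w => h w * posPow a (s - k * (w ⬝ᵥ (D *ᵥ w)))) √s
  simp only [hh.mul_posPow_smul D a k hs, integral_const_mul, Module.finrank_fin_fun,
    smul_eq_mul] at h1
  rw [abs_of_pos (by positivity), eq_inv_mul_iff_mul_eq₀ (by positivity)] at h1
  rw [← h1, ← mul_assoc]
  congr 1
  rw [Real.sqrt_eq_rpow, ← Real.rpow_natCast, ← Real.rpow_natCast, ← Real.rpow_mul hs.le,
    ← Real.rpow_mul hs.le, ← Real.rpow_add hs, ← Real.rpow_add hs]
  congr 1; ring

/-- Moments of the compactly supported weight `(1 - k ⟨w, D w⟩)₊ ^ a` in terms of Gaussian ones. -/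
lemma Homog.integral_mul_posPow (hh : Homog d h) {D : Matrix (Fin n) (Fin n) ℝ}
    (hD : D.PosDef) {a k : ℝ} (hk : 0 < k) (ha : -1 < a) :
    Integrable (fun w => h w * posPow a (1 - k * (w ⬝ᵥ (D *ᵥ w)))) ∧
    ∫ w, h w * posPow a (1 - k * (w ⬝ᵥ (D *ᵥ w))) =
      Gamma (a + 1) / Gamma (a + 1 + ((n : ℝ) + d) / 2) *
        ((2 * k) ^ (-(((n : ℝ) + d) / 2)) * gaussMoment D h) := by
  have hnd : 0 ≤ ((n : ℝ) + d) / 2 := by positivity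
  have hΓ : 0 < Gamma (a + 1 + ((n : ℝ) + d) / 2) := Real.Gamma_pos_of_pos (by linarith)
  have hQ := PosDef.quadratic_nonneg hD
  -- Integrating over `s` gives `Γ(a + 1) h(w) exp (-k⟨w, Dw⟩)`; integrating over `w` first gives,
  -- by dilation, a power of `s` times the wanted moment.
  set F : (Fin n → ℝ) → ℝ → ℝ := fun w s =>
    h w * (posPow a (s - k * (w ⬝ᵥ (D *ᵥ w))) * exp (-s)) with hF
  have hmeas : Measurable (Function.uncurry F) := by
    have h1 := hh.cont.measurable
    have h2 := (Homog.quadratic D).cont.measurable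
    have h3 := measurable_posPow a
    simp only [hF, Function.uncurry_def]
    fun_prop
  have hint : Integrable (Function.uncurry F) (volume.prod volume) := by
    rw [integrable_prod_iff hmeas.aestronglyMeasurable]
    constructor
    · refine ae_of_all _ fun w => ?_
      exact (integrable_posPow_sub_mul_exp ha (k * (w ⬝ᵥ (D *ᵥ w)))).const_mul (h w)
    · refine ((hh.abs.integrable_mul_exp hD hk).mul_const (Gamma (a + 1))).congr
        (ae_of_all _ fun w => ?_)
      simp only [hF, Function.uncurry, norm_mul, Real.norm_eq_abs, Real.abs_exp,
        abs_of_nonneg (posPow_nonneg _ _), integral_const_mul]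
      rw [integral_posPow_sub_mul_exp ha, mul_assoc]
  -- Fubini gives integrable slices only for almost every `s`. One such `s > 0` is enough, since
  -- dilation by `√s` carries it to `s = 1`.
  have hslice : Integrable (fun w => h w * posPow a (1 - k * (w ⬝ᵥ (D *ᵥ w)))) := by
    have hev := hint.prod_left_ae
    obtain ⟨s, hs, hsi⟩ : ∃ s : ℝ, 0 < s ∧ Integrable (fun w => F w s) := by
      by_contra! H
      have : volume (Set.Ioi (0 : ℝ)) = 0 :=
        measure_mono_null (fun s hs hi => H s hs hi) hev
      simp at this
    have hR : 0 < √s := Real.sqrt_pos.2 hs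
    have h1 := (integrable_comp_smul_iff volume (fun w => F w s) hR.ne').2 hsi
    simp only [hF, ← mul_assoc, hh.mul_posPow_smul D a k hs] at h1
    have h2 := (h1.mul_const (exp (-s))⁻¹).const_mul (√s ^ d * s ^ a)⁻¹
    refine h2.congr (ae_of_all _ fun w => ?_)
    have : 0 < s ^ a := Real.rpow_pos_of_pos hs _
    field_simp
  refine ⟨hslice, ?_⟩
  have h2 := integral_integral_swap hint
  have hin : ∀ w, ∫ s, F w s = Gamma (a + 1) * (h w * exp (-(k * (w ⬝ᵥ (D *ᵥ w))))) := by
    intro w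
    simp only [hF, integral_const_mul, integral_posPow_sub_mul_exp ha]
    ring
  have hout : ∀ s, ∫ w, F w s = posPow (a + ((n : ℝ) + d) / 2) s * exp (-s) *
      ∫ w, h w * posPow a (1 - k * (w ⬝ᵥ (D *ᵥ w))) := by
    intro s
    simp only [hF, ← mul_assoc, integral_mul_const]
    rcases lt_or_ge 0 s with hs | hs
    · rw [hh.integral_mul_posPow_sub D a k s hs, posPow_of_pos hs]
      ring
    · have : ∀ w : Fin n → ℝ, posPow a (s - k * (w ⬝ᵥ (D *ᵥ w))) = 0 := fun w =>
        posPow_of_nonpos (by have := mul_nonneg hk.le (hQ w); linarith)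
      simp [this, posPow_of_nonpos hs]
  simp only [hin, hout, integral_const_mul, integral_mul_const] at h2
  rw [hh.integral_mul_exp D hk, integral_posPow_mul_exp (by linarith),
    show a + ((n : ℝ) + d) / 2 + 1 = a + 1 + ((n : ℝ) + d) / 2 by ring] at h2
  rw [div_mul_eq_mul_div, eq_div_iff hΓ.ne', mul_comm, h2]

end Mixture

/-! ### Gaussian moments up to degree four -/

section Gauss

variable {n d e : ℕ}

open scoped MatrixOrder in
lemma PosDef.exists_eq_transpose_mul_self {D : Matrix (Fin n) (Fin n) ℝ} (hD : D.PosDef) :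
    ∃ B : Matrix (Fin n) (Fin n) ℝ, D = Bᵀ * B := by
  obtain ⟨B, hB⟩ := CStarAlgebra.nonneg_iff_eq_star_mul_self.1
    (Matrix.nonneg_iff_posSemidef.2 hD.posSemidef)
  exact ⟨B, by simpa [Matrix.star_eq_conjTranspose] using hB⟩

lemma integral_exp_neg_dotProduct_self :
    ∫ v : Fin n → ℝ, exp (-(1 / 2 * (v ⬝ᵥ v))) = √((2 * π) ^ n) := by
  have h1 : ∀ v : Fin n → ℝ, exp (-(1 / 2 * (v ⬝ᵥ v))) = ∏ i, exp (-(1 / 2) * v i ^ 2) := by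
    intro v
    rw [← Real.exp_sum, dotProduct, Finset.mul_sum, ← Finset.sum_neg_distrib]
    congr 1
    exact Finset.sum_congr rfl fun i _ => by ring
  simp only [h1]
  rw [integral_fintype_prod_volume_eq_pow (fun x : ℝ => exp (-(1 / 2) * x ^ 2)), integral_gaussian,
    Fintype.card_fin, Real.sqrt_eq_rpow, Real.sqrt_eq_rpow, ← Real.rpow_natCast,
    ← Real.rpow_natCast, ← Real.rpow_mul (by positivity), ← Real.rpow_mul (by positivity)]
  congr 1 <;> ring

/-- With `D = BᵀB`, substitute `v = Bw`; the Jacobian is `|det B| = √(det D)`. -/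
lemma gaussMoment_one {D : Matrix (Fin n) (Fin n) ℝ} (hD : D.PosDef) :
    √D.det * gaussMoment D (fun _ => 1) = √((2 * π) ^ n) := by
  obtain ⟨B, hB⟩ := PosDef.exists_eq_transpose_mul_self hD
  have hdet : D.det = B.det ^ 2 := by rw [hB, Matrix.det_mul, Matrix.det_transpose]; ring
  have hB0 : B.det ≠ 0 := by
    intro h0
    have := hD.det_pos
    rw [hdet, h0] at this
    simp at this
  have hq : ∀ w : Fin n → ℝ, w ⬝ᵥ (D *ᵥ w) = (B *ᵥ w) ⬝ᵥ (B *ᵥ w) := by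
    intro w
    rw [hB, ← Matrix.mulVec_mulVec, Matrix.dotProduct_mulVec, Matrix.vecMul_transpose]
  have hcont : Continuous (fun v : Fin n → ℝ => exp (-(1 / 2 * (v ⬝ᵥ v)))) := by fun_prop
  have h1 := Real.map_matrix_volume_pi_eq_smul_volume_pi hB0
  have h2 := integral_map (μ := volume) (φ := Matrix.toLin' B)
    (LinearMap.continuous_of_finiteDimensional _).aemeasurable
    (f := fun v : Fin n → ℝ => exp (-(1 / 2 * (v ⬝ᵥ v)))) hcont.aestronglyMeasurable
  rw [h1, integral_smul_measure, integral_exp_neg_dotProduct_self,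
    ENNReal.toReal_ofReal (abs_nonneg _)] at h2
  simp only [gaussMoment, one_mul, hq]
  simp only [Matrix.toLin'_apply, smul_eq_mul] at h2
  rw [← h2, hdet, Real.sqrt_sq_eq_abs, ← mul_assoc, ← abs_mul, mul_inv_cancel₀ hB0, abs_one, one_mul]

lemma Homog.integrable_gauss {h : (Fin n → ℝ) → ℝ} (hh : Homog d h)
    {D : Matrix (Fin n) (Fin n) ℝ} (hD : D.PosDef) :
    Integrable (fun w => h w * exp (-(1 / 2 * (w ⬝ᵥ (D *ᵥ w))))) :=
  hh.integrable_mul_exp hD (by norm_num)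

/-- Odd functions have vanishing Gaussian moment. -/
lemma gaussMoment_of_odd (D : Matrix (Fin n) (Fin n) ℝ) {h : (Fin n → ℝ) → ℝ}
    (hodd : ∀ w, h (-w) = -h w) : gaussMoment D h = 0 := by
  have h1 := integral_neg_eq_self (μ := (volume : Measure (Fin n → ℝ)))
    (fun w => h w * exp (-(1 / 2 * (w ⬝ᵥ (D *ᵥ w)))))
  simp only [hodd, Matrix.mulVec_neg, neg_dotProduct, dotProduct_neg, neg_neg, neg_mul,
    integral_neg] at h1
  unfold gaussMoment
  linarith

lemma gaussMoment_const_mul (D : Matrix (Fin n) (Fin n) ℝ) (c : ℝ) (h : (Fin n → ℝ) → ℝ) :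
    gaussMoment D (fun w => c * h w) = c * gaussMoment D h := by
  simp only [gaussMoment, mul_assoc, integral_const_mul]

lemma gaussMoment_add {D : Matrix (Fin n) (Fin n) ℝ} (hD : D.PosDef) {h k : (Fin n → ℝ) → ℝ}
    (hh : Homog d h) (hk : Homog e k) :
    gaussMoment D (fun w => h w + k w) = gaussMoment D h + gaussMoment D k := by
  simp only [gaussMoment, add_mul]
  exact integral_add (hh.integrable_gauss hD) (hk.integrable_gauss hD)

lemma gaussMoment_sum {D : Matrix (Fin n) (Fin n) ℝ} (hD : D.PosDef) {ι : Type*} (s : Finset ι)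
    {h : ι → (Fin n → ℝ) → ℝ} (hh : ∀ i ∈ s, Homog d (h i)) :
    gaussMoment D (fun w => ∑ i ∈ s, h i w) = ∑ i ∈ s, gaussMoment D (h i) := by
  simp only [gaussMoment, Finset.sum_mul]
  exact integral_finsetSum _ fun i hi => (hh i hi).integrable_gauss hD

/-- Gaussian integration by parts in the direction `v`. -/
lemma gaussMoment_mul_linear {D : Matrix (Fin n) (Fin n) ℝ} (hD : D.PosDef) (v : Fin n → ℝ)
    {g g' : (Fin n → ℝ) → ℝ} (hg : Homog d g) (hg' : Homog e g')
    (hgg' : ∀ w, HasDerivAt (fun t : ℝ => g (w + t • v)) (g' w) 0) :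
    gaussMoment D (fun w => (D *ᵥ v) ⬝ᵥ w * g w) = gaussMoment D g' := by
  have hsymm : ∀ w : Fin n → ℝ, w ⬝ᵥ (D *ᵥ v) = v ⬝ᵥ (D *ᵥ w) := fun w => by
    have : Dᵀ = D := by
      simpa [Matrix.IsSymm] using hD.isHermitian
    rw [Matrix.dotProduct_mulVec, ← Matrix.mulVec_transpose, this, dotProduct_comm]
  have hE : ∀ w : Fin n → ℝ, HasLineDerivAt ℝ
      (fun w : Fin n → ℝ => exp (-(1 / 2 * (w ⬝ᵥ (D *ᵥ w)))))
      (-((D *ᵥ v) ⬝ᵥ w) * exp (-(1 / 2 * (w ⬝ᵥ (D *ᵥ w))))) w v := by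
    intro w
    unfold HasLineDerivAt
    have h1 : ∀ t : ℝ, (w + t • v) ⬝ᵥ (D *ᵥ (w + t • v)) =
        w ⬝ᵥ (D *ᵥ w) + t * (2 * (w ⬝ᵥ (D *ᵥ v))) + t ^ 2 * (v ⬝ᵥ (D *ᵥ v)) := by
      intro t
      simp only [Matrix.mulVec_add, Matrix.mulVec_smul, add_dotProduct, dotProduct_add,
        smul_dotProduct, dotProduct_smul, smul_eq_mul, ← hsymm w]
      ring
    simp only [h1]
    have h2 : HasDerivAt (fun t : ℝ => -(1 / 2 * (w ⬝ᵥ (D *ᵥ w) + t * (2 * (w ⬝ᵥ (D *ᵥ v))) +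
        t ^ 2 * (v ⬝ᵥ (D *ᵥ v))))) (-(w ⬝ᵥ (D *ᵥ v))) 0 := by
      have := ((((hasDerivAt_id (0 : ℝ)).mul_const (2 * (w ⬝ᵥ (D *ᵥ v)))).const_add
        (w ⬝ᵥ (D *ᵥ w))).add (((hasDerivAt_id (0 : ℝ)).pow 2).mul_const
          (v ⬝ᵥ (D *ᵥ v)))).const_mul (1 / 2) |>.neg
      refine this.congr_deriv ?_
      simp
    refine h2.exp.congr_deriv ?_
    rw [dotProduct_comm (D *ᵥ v)]
    simp [mul_comm]
  have hDv : Homog 1 (fun w : Fin n → ℝ => (D *ᵥ v) ⬝ᵥ w) := Homog.linear _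
  have hint := (hDv.mul hg).integrable_gauss hD
  have key := integral_bilinear_hasLineDerivAt_right_eq_neg_left_of_integrable
    (μ := (volume : Measure (Fin n → ℝ))) (B := ContinuousLinearMap.mul ℝ ℝ) (v := v)
    (f := g) (f' := g') (g := fun w : Fin n → ℝ => exp (-(1 / 2 * (w ⬝ᵥ (D *ᵥ w)))))
    (g' := fun w => -((D *ᵥ v) ⬝ᵥ w) * exp (-(1 / 2 * (w ⬝ᵥ (D *ᵥ w)))))
    (by simpa using hg'.integrable_gauss hD)
    (by
      refine hint.neg.congr (ae_of_all _ fun w => ?_)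
      simp only [Pi.neg_apply, ContinuousLinearMap.mul_apply']
      ring)
    (by simpa using hg.integrable_gauss hD)
    (fun w _ => hgg' w) (fun w _ => hE w)
  simp only [ContinuousLinearMap.mul_apply'] at key
  unfold gaussMoment
  rw [← neg_eq_iff_eq_neg.2 key, ← integral_neg]
  congr 1
  ext w
  ring

/-- Integration by parts along `v` produces the factor `⟨Dv, w⟩`; along a column of `D⁻¹` this is a
single coordinate. -/
lemma PosDef.mulVec_inv_col {D : Matrix (Fin n) (Fin n) ℝ} (hD : D.PosDef) (i : Fin n)
    (w : Fin n → ℝ) : (D *ᵥ D⁻¹.col i) ⬝ᵥ w = w i := by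
  have h1 : D * D⁻¹ = 1 := Matrix.mul_nonsing_inv _ hD.det_pos.ne'.isUnit
  have : D *ᵥ D⁻¹.col i = Pi.single i 1 := by
    rw [← Matrix.mulVec_single_one, Matrix.mulVec_mulVec, h1, Matrix.one_mulVec]
  rw [this, single_dotProduct, one_mul]

/-- Gaussian integration by parts for the vector field `w ↦ M w` times a function. -/
lemma gaussMoment_quadratic_mul {D : Matrix (Fin n) (Fin n) ℝ} (hD : D.PosDef)
    (M : Matrix (Fin n) (Fin n) ℝ) {g : (Fin n → ℝ) → ℝ} (hg : Homog d g)
    {g' : Fin n → (Fin n → ℝ) → ℝ} (hg' : ∀ i, Homog d (fun w => (M *ᵥ w) i * g' i w))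
    (hgg' : ∀ i w, HasDerivAt (fun t : ℝ => g (w + t • D⁻¹.col i)) (g' i w) 0) :
    gaussMoment D (fun w => w ⬝ᵥ (M *ᵥ w) * g w) =
      (D⁻¹ * M).trace * gaussMoment D g + gaussMoment D (fun w => ∑ i, (M *ᵥ w) i * g' i w) := by
  have hrow : ∀ i, Homog 1 (fun w : Fin n → ℝ => (M *ᵥ w) i) := fun i => Homog.linear (M i)
  -- Each coordinate `w i` of `∑ w i (Mw) i` is removed by parts; differentiating `(Mw) i` leaves
  -- `(M D⁻¹) i i`, and these sum to the trace.
  have h1 : ∀ w : Fin n → ℝ, w ⬝ᵥ (M *ᵥ w) * g w =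
      ∑ i, (D *ᵥ D⁻¹.col i) ⬝ᵥ w * ((M *ᵥ w) i * g w) := by
    intro w
    simp only [PosDef.mulVec_inv_col hD]
    simp only [dotProduct, Finset.sum_mul, mul_assoc]
  have h2 : ∀ i, gaussMoment D (fun w => (D *ᵥ D⁻¹.col i) ⬝ᵥ w * ((M *ᵥ w) i * g w)) =
      (M * D⁻¹) i i * gaussMoment D g + gaussMoment D (fun w => (M *ᵥ w) i * g' i w) := by
    intro i
    have hk1 : Homog d (fun w => (M * D⁻¹) i i * g w) := by
      simpa using (Homog.const ((M * D⁻¹) i i)).mul hg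
    rw [← gaussMoment_const_mul, ← gaussMoment_add hD hk1 (hg' i)]
    refine gaussMoment_mul_linear hD _ ((hrow i).mul hg) (hk1.add (hg' i)) fun w => ?_
    have hM : HasDerivAt (fun t : ℝ => (M *ᵥ (w + t • D⁻¹.col i)) i) ((M * D⁻¹) i i) 0 := by
      have : ∀ t : ℝ, (M *ᵥ (w + t • D⁻¹.col i)) i = (M *ᵥ w) i + t * (M * D⁻¹) i i := by
        intro t
        rw [Matrix.mulVec_add, Matrix.mulVec_smul]
        rfl
      simp only [this]
      simpa using ((hasDerivAt_id (0 : ℝ)).mul_const ((M * D⁻¹) i i)).const_add ((M *ᵥ w) i)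
    refine (hM.fun_mul (hgg' i w)).congr_deriv ?_
    simp
  simp only [h1]
  rw [gaussMoment_sum hD (d := 1 + (1 + d)) _
    (fun i _ => (Homog.linear _).mul ((hrow i).mul hg)), Finset.sum_congr rfl fun i _ => h2 i,
    Finset.sum_add_distrib, ← Finset.sum_mul, Matrix.trace_mul_comm,
    gaussMoment_sum hD _ fun i _ => hg' i]
  rfl

lemma gaussMoment_quadratic {D : Matrix (Fin n) (Fin n) ℝ} (hD : D.PosDef)
    (M : Matrix (Fin n) (Fin n) ℝ) :
    gaussMoment D (fun w => w ⬝ᵥ (M *ᵥ w)) = (D⁻¹ * M).trace * gaussMoment D (fun _ => 1) := by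
  have h1 := gaussMoment_quadratic_mul hD M (Homog.const 1) (g' := fun _ _ => 0)
    (fun i => by simpa using Homog.const 0) (fun i w => hasDerivAt_const _ _)
  have h2 : gaussMoment D (fun _ => 0) = 0 := by simp [gaussMoment]
  simpa [h2] using h1

/-- Integrating `⟨w, Xw⟩` by parts against `⟨w, Yw⟩` leaves the quadratic form `2⟨w, Y D⁻¹ X w⟩`,
whose moment is the second trace. Symmetry of `Y` merges the two derivative terms. -/
lemma gaussMoment_quadratic_mul_quadratic {D : Matrix (Fin n) (Fin n) ℝ} (hD : D.PosDef)
    (X : Matrix (Fin n) (Fin n) ℝ) {Y : Matrix (Fin n) (Fin n) ℝ} (hY : Y.IsSymm) :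
    gaussMoment D (fun w => w ⬝ᵥ (X *ᵥ w) * (w ⬝ᵥ (Y *ᵥ w))) =
      ((D⁻¹ * X).trace * (D⁻¹ * Y).trace + 2 * (D⁻¹ * X * D⁻¹ * Y).trace) *
        gaussMoment D (fun _ => 1) := by
  have hYt : ∀ v w : Fin n → ℝ, v ⬝ᵥ (Y *ᵥ w) = (Y *ᵥ v) ⬝ᵥ w := fun v w => by
    rw [Matrix.dotProduct_mulVec, ← Matrix.mulVec_transpose, hY.eq]
  have hlin : ∀ i, Homog 1 (fun w => D⁻¹.col i ⬝ᵥ (Y *ᵥ w)) := fun i => by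
    simpa only [hYt] using Homog.linear _
  rw [gaussMoment_quadratic_mul hD X (Homog.quadratic Y)
    (g' := fun i w => 2 * (D⁻¹.col i ⬝ᵥ (Y *ᵥ w)))
    (fun i => Homog.mul (d := 1) (Homog.linear (X i)) (by
      simpa using (Homog.const 2).mul (hlin i)))]
  · have h1 : ∀ w : Fin n → ℝ, ∑ i, (X *ᵥ w) i * (2 * (D⁻¹.col i ⬝ᵥ (Y *ᵥ w))) =
        2 * (w ⬝ᵥ ((Y * (D⁻¹ * X)) *ᵥ w)) := by
      intro w
      rw [← Matrix.mulVec_mulVec, hYt, ← Matrix.mulVec_mulVec, Matrix.dotProduct_mulVec,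
        dotProduct_comm, dotProduct, Finset.mul_sum]
      refine Finset.sum_congr rfl fun i _ => ?_
      rw [dotProduct_comm (D⁻¹.col i)]
      simp only [Matrix.vecMul]
      ring!
    simp only [h1]
    rw [gaussMoment_const_mul, gaussMoment_quadratic hD, gaussMoment_quadratic hD,
      ← Matrix.mul_assoc, Matrix.trace_mul_comm (D⁻¹ * Y), ← Matrix.mul_assoc]
    ring
  · intro i w
    have h1 : ∀ t : ℝ, (w + t • D⁻¹.col i) ⬝ᵥ (Y *ᵥ (w + t • D⁻¹.col i)) =
        w ⬝ᵥ (Y *ᵥ w) + t * (2 * (D⁻¹.col i ⬝ᵥ (Y *ᵥ w))) +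
          t ^ 2 * (D⁻¹.col i ⬝ᵥ (Y *ᵥ D⁻¹.col i)) := by
      intro t
      have : w ⬝ᵥ (Y *ᵥ D⁻¹.col i) = D⁻¹.col i ⬝ᵥ (Y *ᵥ w) := by
        rw [hYt, dotProduct_comm]
      simp only [Matrix.mulVec_add, Matrix.mulVec_smul, add_dotProduct, dotProduct_add,
        smul_dotProduct, dotProduct_smul, smul_eq_mul, this]
      ring
    simp only [h1]
    have := (((hasDerivAt_id (0 : ℝ)).mul_const (2 * (D⁻¹.col i ⬝ᵥ (Y *ᵥ w)))).const_add
        (w ⬝ᵥ (Y *ᵥ w))).add (((hasDerivAt_id (0 : ℝ)).pow 2).mul_const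
          (D⁻¹.col i ⬝ᵥ (Y *ᵥ D⁻¹.col i)))
    refine this.congr_deriv ?_
    simp

lemma gaussMoment_linear_mul_linear {D : Matrix (Fin n) (Fin n) ℝ} (hD : D.PosDef)
    (x y : Fin n → ℝ) :
    gaussMoment D (fun w => (D *ᵥ x) ⬝ᵥ w * ((D *ᵥ y) ⬝ᵥ w)) =
      x ⬝ᵥ (D *ᵥ y) * gaussMoment D (fun _ => 1) := by
  rw [gaussMoment_mul_linear hD x (Homog.linear _) (Homog.const (x ⬝ᵥ (D *ᵥ y))),
    ← gaussMoment_const_mul]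
  · simp
  · intro w
    have : ∀ t : ℝ, (D *ᵥ y) ⬝ᵥ (w + t • x) = (D *ᵥ y) ⬝ᵥ w + t * (x ⬝ᵥ (D *ᵥ y)) := fun t => by
      rw [dotProduct_add, dotProduct_smul, dotProduct_comm _ x, smul_eq_mul]
    simp only [this]
    simpa using ((hasDerivAt_id (0 : ℝ)).mul_const (x ⬝ᵥ (D *ᵥ y))).const_add ((D *ᵥ y) ⬝ᵥ w)

end Gauss

/-! ### Weights `f_p / base^j` and their moment ratios -/

section Weights

variable {n d : ℕ} {p : ℝ}

/-- The denominator `2 p - n (1 - p)`, which is positive on the label set. -/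
def scale (n : ℕ) (p : ℝ) : ℝ := 2 * p - (n : ℝ) * (1 - p)

lemma scale_pos (hnp : (n, p) ∈ labelSet) : 0 < scale n p := by
  have h := hnp.2
  simp only at h
  rw [div_lt_iff₀ (by positivity)] at h
  unfold scale
  linarith

/-- The density divided by the `j`-th power of its base, as a function of `w = z - u`. -/
def weight (p : ℝ) (D : Matrix (Fin n) (Fin n) ℝ) (j : ℕ) (w : Fin n → ℝ) : ℝ :=
  if p = 1 then √D.det / √((2 * π) ^ n) * exp (-(1 / 2 * (w ⬝ᵥ (D *ᵥ w))))
  else normConst n p * √D.det *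
    posPow (1 / (p - 1) - j) (1 + (1 - p) / scale n p * (w ⬝ᵥ (D *ᵥ w)))

lemma gaussMoment_one_pos {D : Matrix (Fin n) (Fin n) ℝ} (hD : D.PosDef) :
    0 < gaussMoment D (fun _ => 1) := by
  have h1 := gaussMoment_one hD
  have h2 : 0 < √((2 * π) ^ n) := by positivity
  rw [← h1] at h2
  exact (pos_iff_pos_of_mul_pos h2).1 (Real.sqrt_pos.2 hD.det_pos)

/-- The power of `c` in the normalizing constant cancels the `n`-dependent part of the dilation
factor, leaving a power that depends only on the degree. -/
lemma rpow_normalization {c : ℝ} (hc : 0 < c) (n d : ℕ) :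
    c ^ ((n : ℝ) / 2) * ((2 * c) ^ (-(((n : ℝ) + d) / 2)) * √((2 * π) ^ n)) =
      π ^ ((n : ℝ) / 2) * (2 * c) ^ (-((d : ℝ) / 2)) := by
  have h1 : √((2 * π) ^ n) = 2 ^ ((n : ℝ) / 2) * π ^ ((n : ℝ) / 2) := by
    rw [Real.sqrt_eq_rpow, ← Real.rpow_natCast, ← Real.rpow_mul (by positivity),
      Real.mul_rpow (by positivity) (by positivity)]
    congr 2 <;> ring
  have h2 : (2 * c) ^ (-(((n : ℝ) + d) / 2)) =
      (2 * c) ^ (-((d : ℝ) / 2)) / (2 ^ ((n : ℝ) / 2) * c ^ ((n : ℝ) / 2)) := by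
    rw [← Real.mul_rpow (by positivity) hc.le, ← Real.rpow_sub (by positivity)]
    congr 1; ring
  have h3 : 0 < c ^ ((n : ℝ) / 2) := by positivity
  have h4 : (0 : ℝ) < 2 ^ ((n : ℝ) / 2) := by positivity
  rw [h1, h2]
  field_simp

lemma rpow_neg_two_div_two (x : ℝ) : x ^ (-((2 : ℕ) / 2 : ℝ)) = x⁻¹ := by
  rw [show (-((2 : ℕ) / 2 : ℝ)) = -1 by norm_num, Real.rpow_neg_one]

lemma rpow_neg_four_div_two {x : ℝ} (hx : 0 < x) : x ^ (-((4 : ℕ) / 2 : ℝ)) = (x⁻¹) ^ 2 := by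
  rw [show (-((4 : ℕ) / 2 : ℝ)) = -((2 : ℕ) : ℝ) by norm_num, Real.rpow_neg hx.le,
    Real.rpow_natCast, inv_pow]

/-- Ratio between the moments of `weight p D j` and the Gaussian moments, in degree `d`. -/
def momentRatio (n : ℕ) (p : ℝ) (d j : ℕ) : ℝ :=
  if p = 1 then 1
  else if p < 1 then
    (2 * ((1 - p) / scale n p)) ^ (-((d : ℝ) / 2)) *
      (Gamma (1 / (1 - p)) / Gamma (1 / (1 - p) + j) *
        (Gamma (1 / (1 - p) + j - ((n : ℝ) + d) / 2) / Gamma (1 / (1 - p) - (n : ℝ) / 2)))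
  else
    (2 * ((p - 1) / scale n p)) ^ (-((d : ℝ) / 2)) *
      (Gamma (1 / (p - 1) - j + 1) / Gamma (1 / (p - 1) + 1) *
        (Gamma (1 / (p - 1) + 1 + (n : ℝ) / 2) /
          Gamma (1 / (p - 1) - j + 1 + ((n : ℝ) + d) / 2)))

/-- This is `scale n p > 0` rearranged; it keeps the Gamma arguments positive for `p < 1`. -/
lemma half_lt_inv_one_sub (hnp : (n, p) ∈ labelSet) (hp : p < 1) :
    (n : ℝ) / 2 + 1 < 1 / (1 - p) := by
  have h := scale_pos hnp
  unfold scale at h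
  rw [lt_div_iff₀ (by linarith)]
  linarith

/-- The bound `p < 2` keeps the exponent `1/(p-1) - j` above `-1` for `j ≤ 2`. -/
lemma one_lt_inv_sub_one (hp1 : 1 < p) (hp : p < 2) : 1 < 1 / (p - 1) := by
  rw [lt_div_iff₀ (by linarith)]
  linarith

lemma div_sub_one_eq (hp1 : 1 < p) : p / (p - 1) = 1 / (p - 1) + 1 := by
  have : p - 1 ≠ 0 := by linarith
  field_simp
  ring

lemma normConst_pos (hnp : (n, p) ∈ labelSet) (hp1 : p ≠ 1) : 0 < normConst n p := by
  have hm := scale_pos hnp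
  unfold scale at hm
  unfold normConst
  split_ifs with h
  · have h1 := half_lt_inv_one_sub hnp h
    have hn : (0 : ℝ) ≤ n := by positivity
    have h2 : 0 < 1 - p := by linarith
    have := Real.Gamma_pos_of_pos (s := 1 / (1 - p)) (by linarith)
    have := Real.Gamma_pos_of_pos (s := 1 / (1 - p) - (n : ℝ) / 2) (by linarith)
    positivity
  · have h1 : 1 < p := lt_of_le_of_ne (not_lt.1 h) (Ne.symm hp1)
    have h2 : 0 < p - 1 := by linarith
    have := Real.Gamma_pos_of_pos (s := p / (p - 1)) (by positivity)
    have := Real.Gamma_pos_of_pos (s := p / (p - 1) + (n : ℝ) / 2) (by positivity)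
    positivity

/-- Moments of the weights are multiples of Gaussian moments. -/
lemma Homog.integral_mul_weight (hnp : (n, p) ∈ labelSet) (hp : p < 2)
    {D : Matrix (Fin n) (Fin n) ℝ} (hD : D.PosDef) {h : (Fin n → ℝ) → ℝ} (hh : Homog d h)
    {j : ℕ} (hdj : d ≤ 2 * j) (hj : j ≤ 2) :
    Integrable (fun w => h w * weight p D j w) ∧
    gaussMoment D (fun _ => 1) * ∫ w, h w * weight p D j w =
      momentRatio n p d j * gaussMoment D h := by
  have hm := scale_pos hnp
  have hG := gaussMoment_one hD
  have hn : (0 : ℝ) ≤ n := by positivity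
  have hdj' : (d : ℝ) ≤ 2 * j := by exact_mod_cast hdj
  have hj' : (j : ℝ) ≤ 2 := by exact_mod_cast hj
  have hπ : 0 < π ^ ((n : ℝ) / 2) := by positivity
  rcases lt_trichotomy p 1 with hp1 | hp1 | hp1
  · have h1p : 0 < 1 - p := by linarith
    have ha := half_lt_inv_one_sub hnp hp1
    set a := 1 / (1 - p) with ha_def
    set c := (1 - p) / scale n p with hc_def
    have hc : 0 < c := by positivity
    have hw : ∀ w : Fin n → ℝ, h w * weight p D j w =
        normConst n p * √D.det * (h w * (1 + c * (w ⬝ᵥ (D *ᵥ w))) ^ (-(a + j))) := by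
      intro w
      have h2 : 0 < 1 + c * (w ⬝ᵥ (D *ᵥ w)) := by
        have := mul_nonneg hc.le (PosDef.quadratic_nonneg hD w); linarith
      have h3 : 1 / (p - 1) - (j : ℝ) = -(a + j) := by
        rw [ha_def, ← neg_sub 1 p, one_div_neg_eq_neg_one_div]; ring
      rw [weight, if_neg hp1.ne, ← hc_def, posPow_of_pos h2, h3]
      ring
    obtain ⟨hi, hv⟩ := hh.integral_mul_one_add_rpow hD hc
      -- Since `d ≤ 2j`, `(n + d)/2 ≤ n/2 + j < a + j`.
      (b := a + j) (by linarith)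
    simp only [hw]
    refine ⟨hi.const_mul _, ?_⟩
    have hΓ1 := Real.Gamma_pos_of_pos (s := a - (n : ℝ) / 2) (by linarith)
    have hΓ2 := Real.Gamma_pos_of_pos (s := a + j) (by positivity)
    have hN := rpow_normalization hc n d
    rw [integral_const_mul, hv, momentRatio, if_neg hp1.ne, if_pos hp1, ← hc_def, ← ha_def,
      normConst, if_pos hp1, ← scale, ← hc_def, ← ha_def]
    -- Writing `√((2π)^n)` as `√(det D)` times the Gaussian mass makes the determinant cancel.
    rw [← hG] at hN
    calc _ = (c ^ ((n : ℝ) / 2) * ((2 * c) ^ (-(((n : ℝ) + d) / 2)) *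
          (√D.det * gaussMoment D (fun _ => 1)))) / π ^ ((n : ℝ) / 2) *
          (Gamma a / Gamma (a + j) *
            (Gamma (a + j - ((n : ℝ) + d) / 2) / Gamma (a - (n : ℝ) / 2))) * gaussMoment D h := by
          field_simp
      _ = _ := by rw [hN]; field_simp
  · subst hp1
    have hw : ∀ w : Fin n → ℝ, h w * weight 1 D j w =
        √D.det / √((2 * π) ^ n) * (h w * exp (-(1 / 2 * (w ⬝ᵥ (D *ᵥ w))))) := by
      intro w
      rw [weight, if_pos rfl]; ring
    simp only [hw]
    refine ⟨(hh.integrable_gauss hD).const_mul _, ?_⟩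
    have h2 : 0 < √((2 * π) ^ n) := by positivity
    rw [integral_const_mul, ← gaussMoment, momentRatio, if_pos rfl, one_mul, ← mul_assoc,
      mul_div_assoc', mul_comm (gaussMoment D _), hG, div_self h2.ne', one_mul]
  · have h1p : 0 < p - 1 := by linarith
    have ha := one_lt_inv_sub_one hp1 hp
    have hpa := div_sub_one_eq hp1
    set a := 1 / (p - 1) with ha_def
    set k := (p - 1) / scale n p with hk_def
    have hk : 0 < k := by positivity
    have hck : (1 - p) / scale n p = -k := by rw [hk_def]; ring
    have hw : ∀ w : Fin n → ℝ, h w * weight p D j w =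
        normConst n p * √D.det * (h w * posPow (a - j) (1 - k * (w ⬝ᵥ (D *ᵥ w)))) := by
      intro w
      rw [weight, if_neg hp1.ne', hck, neg_mul, ← sub_eq_add_neg]
      ring
    obtain ⟨hi, hv⟩ := hh.integral_mul_posPow hD hk (a := a - j) (by linarith)
    simp only [hw]
    refine ⟨hi.const_mul _, ?_⟩
    have hd0 : (0 : ℝ) ≤ d := by positivity
    have hΓ1 := Real.Gamma_pos_of_pos (s := a + 1) (by linarith)
    have hΓ2 := Real.Gamma_pos_of_pos (s := a - j + 1 + ((n : ℝ) + d) / 2) (by linarith)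
    have hN := rpow_normalization hk n d
    rw [integral_const_mul, hv, momentRatio, if_neg hp1.ne', if_neg hp1.not_gt, ← hk_def, ← ha_def,
      normConst, if_neg hp1.not_gt, ← scale, ← hk_def, hpa]
    rw [← hG] at hN
    calc _ = (k ^ ((n : ℝ) / 2) * ((2 * k) ^ (-(((n : ℝ) + d) / 2)) *
          (√D.det * gaussMoment D (fun _ => 1)))) / π ^ ((n : ℝ) / 2) *
          (Gamma (a - j + 1) / Gamma (a + 1) *
            (Gamma (a + 1 + (n : ℝ) / 2) / Gamma (a - j + 1 + ((n : ℝ) + d) / 2))) *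
            gaussMoment D h := by
          field_simp
      _ = _ := by rw [hN]; field_simp

lemma Gamma_inv_sub_one_add_one (hp1 : 1 < p) (hp : p < 2) : Gamma (1 / (p - 1) + 1) =
    1 / (p - 1) * ((2 - p) / (p - 1) * Gamma (1 / (p - 1) - 1)) := by
  have h1p : 0 < p - 1 := by linarith
  have ha := one_lt_inv_sub_one hp1 hp
  have h1 := Real.Gamma_add_one (s := 1 / (p - 1) - 1) (by linarith)
  rw [sub_add_cancel] at h1
  rw [Real.Gamma_add_one (by positivity), h1]
  congr 2
  field_simp
  ring

/-- This encodes that the density has total mass one. -/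
lemma momentRatio_zero_zero (hnp : (n, p) ∈ labelSet) (hp : p < 2) : momentRatio n p 0 0 = 1 := by
  have hn : (0 : ℝ) ≤ n := by positivity
  rcases lt_trichotomy p 1 with hp1 | hp1 | hp1
  · have ha := half_lt_inv_one_sub hnp hp1
    have hΓ1 := Real.Gamma_pos_of_pos (s := 1 / (1 - p)) (by linarith)
    have hΓ2 := Real.Gamma_pos_of_pos (s := 1 / (1 - p) - (n : ℝ) / 2) (by linarith)
    rw [momentRatio, if_neg hp1.ne, if_pos hp1]
    simp only [Nat.cast_zero, add_zero, zero_div, neg_zero, Real.rpow_zero, div_self hΓ1.ne',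
      div_self hΓ2.ne', mul_one]
  · rw [momentRatio, if_pos hp1]
  · have ha := one_lt_inv_sub_one hp1 hp
    have hΓ1 := Real.Gamma_pos_of_pos (s := 1 / (p - 1) + 1) (by linarith)
    have hΓ2 := Real.Gamma_pos_of_pos (s := 1 / (p - 1) + 1 + (n : ℝ) / 2) (by linarith)
    rw [momentRatio, if_neg hp1.ne', if_neg hp1.not_gt]
    simp only [Nat.cast_zero, add_zero, sub_zero, zero_div, neg_zero, Real.rpow_zero,
      div_self hΓ1.ne', div_self hΓ2.ne', mul_one]

/-- For `p ≠ 1`, when `d = 2j` the `n`-dependent Gamma quotient is `1`; only `Γ(s)/Γ(s+1)` with `s =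
1/|1-p|` remains. -/
lemma momentRatio_two_one (hnp : (n, p) ∈ labelSet) (hp : p < 2) :
    momentRatio n p 2 1 = scale n p / 2 := by
  have hn : (0 : ℝ) ≤ n := by positivity
  have hm := scale_pos hnp
  rcases lt_trichotomy p 1 with hp1 | hp1 | hp1
  · have h1p : 0 < 1 - p := by linarith
    have ha := half_lt_inv_one_sub hnp hp1
    have hΓ1 := Real.Gamma_pos_of_pos (s := 1 / (1 - p)) (by linarith)
    have hΓ2 := Real.Gamma_pos_of_pos (s := 1 / (1 - p) - (n : ℝ) / 2) (by linarith)
    rw [momentRatio, if_neg hp1.ne, if_pos hp1, rpow_neg_two_div_two,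
      show 1 / (1 - p) + (1 : ℕ) - ((n : ℝ) + (2 : ℕ)) / 2 = 1 / (1 - p) - (n : ℝ) / 2 by
        push_cast; ring, Nat.cast_one, div_self hΓ2.ne', Real.Gamma_add_one (by positivity)]
    field_simp
  · rw [momentRatio, if_pos hp1, scale, hp1]; ring
  · have h1p : 0 < p - 1 := by linarith
    have ha := one_lt_inv_sub_one hp1 hp
    have hΓ1 := Real.Gamma_pos_of_pos (s := 1 / (p - 1)) (by linarith)
    have hΓ2 := Real.Gamma_pos_of_pos (s := 1 / (p - 1) + 1 + (n : ℝ) / 2) (by linarith)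
    rw [momentRatio, if_neg hp1.ne', if_neg hp1.not_gt, rpow_neg_two_div_two,
      show 1 / (p - 1) - (1 : ℕ) + 1 + ((n : ℝ) + (2 : ℕ)) / 2 = 1 / (p - 1) + 1 + (n : ℝ) / 2 by
        push_cast; ring, Nat.cast_one, sub_add_cancel, div_self hΓ2.ne', Real.Gamma_add_one (by positivity)]
    field_simp

lemma momentRatio_four_two (hnp : (n, p) ∈ labelSet) (hp : p < 2) :
    momentRatio n p 4 2 = scale n p ^ 2 / (4 * (2 - p)) := by
  have hn : (0 : ℝ) ≤ n := by positivity
  have hm := scale_pos hnp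
  have h2p : 0 < 2 - p := by linarith
  rcases lt_trichotomy p 1 with hp1 | hp1 | hp1
  · have h1p : 0 < 1 - p := by linarith
    have ha := half_lt_inv_one_sub hnp hp1
    have hΓ1 := Real.Gamma_pos_of_pos (s := 1 / (1 - p)) (by linarith)
    have hΓ2 := Real.Gamma_pos_of_pos (s := 1 / (1 - p) - (n : ℝ) / 2) (by linarith)
    have h3 : 1 / (1 - p) + 1 = (2 - p) / (1 - p) := by field_simp; ring
    rw [momentRatio, if_neg hp1.ne, if_pos hp1, rpow_neg_four_div_two (by positivity),
      show 1 / (1 - p) + (2 : ℕ) - ((n : ℝ) + (4 : ℕ)) / 2 = 1 / (1 - p) - (n : ℝ) / 2 by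
        push_cast; ring,
      show 1 / (1 - p) + (2 : ℕ) = (1 / (1 - p) + 1) + 1 by push_cast; ring,
      Real.Gamma_add_one (by positivity), Real.Gamma_add_one (by positivity), div_self hΓ2.ne', h3]
    field_simp
    norm_num
  · rw [momentRatio, if_pos hp1, scale, hp1]; norm_num
  · have h1p : 0 < p - 1 := by linarith
    have ha := one_lt_inv_sub_one hp1 hp
    have hΓ1 := Real.Gamma_pos_of_pos (s := 1 / (p - 1) - 1) (by linarith)
    have hΓ2 := Real.Gamma_pos_of_pos (s := 1 / (p - 1) + 1 + (n : ℝ) / 2) (by linarith)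
    have h3 := Gamma_inv_sub_one_add_one hp1 hp
    rw [momentRatio, if_neg hp1.ne', if_neg hp1.not_gt, rpow_neg_four_div_two (by positivity),
      show 1 / (p - 1) - (2 : ℕ) + 1 + ((n : ℝ) + (4 : ℕ)) / 2 = 1 / (p - 1) + 1 + (n : ℝ) / 2 by
        push_cast; ring,
      show 1 / (p - 1) - (2 : ℕ) + 1 = 1 / (p - 1) - 1 by push_cast; ring, div_self hΓ2.ne', h3]
    generalize Gamma (1 / (p - 1) - 1) = G at hΓ1
    field_simp
    norm_num

/-- Here `d = 2j - 2`, so for `p ≠ 1` the `n`-dependent quotient contributes one extra factor, `(2 +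
n(p-1)) / (2|1-p|)`. -/
lemma momentRatio_two_two (hnp : (n, p) ∈ labelSet) (hp : p < 2) :
    momentRatio n p 2 2 = scale n p * (2 + n * (p - 1)) / (4 * (2 - p)) := by
  have hn : (0 : ℝ) ≤ n := by positivity
  have hm := scale_pos hnp
  have h2p : 0 < 2 - p := by linarith
  rcases lt_trichotomy p 1 with hp1 | hp1 | hp1
  · have h1p : 0 < 1 - p := by linarith
    have ha := half_lt_inv_one_sub hnp hp1
    have hΓ1 := Real.Gamma_pos_of_pos (s := 1 / (1 - p)) (by linarith)
    have hΓ2 := Real.Gamma_pos_of_pos (s := 1 / (1 - p) - (n : ℝ) / 2) (by linarith)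
    have h3 : 1 / (1 - p) + 1 = (2 - p) / (1 - p) := by field_simp; ring
    have h4 : 1 / (1 - p) - (n : ℝ) / 2 = (2 + n * (p - 1)) / (2 * (1 - p)) := by
      field_simp; ring
    rw [momentRatio, if_neg hp1.ne, if_pos hp1, rpow_neg_two_div_two,
      show 1 / (1 - p) + (2 : ℕ) - ((n : ℝ) + (2 : ℕ)) / 2 = 1 / (1 - p) - (n : ℝ) / 2 + 1 by
        push_cast; ring,
      show 1 / (1 - p) + (2 : ℕ) = (1 / (1 - p) + 1) + 1 by push_cast; ring,
      Real.Gamma_add_one (by positivity), Real.Gamma_add_one (by positivity),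
      Real.Gamma_add_one (by linarith), mul_div_assoc, div_self hΓ2.ne', h3, h4]
    field_simp
    ring
  · rw [momentRatio, if_pos hp1, scale, hp1]; norm_num
  · have h1p : 0 < p - 1 := by linarith
    have ha := one_lt_inv_sub_one hp1 hp
    have hΓ1 := Real.Gamma_pos_of_pos (s := 1 / (p - 1) - 1) (by linarith)
    have hΓ2 := Real.Gamma_pos_of_pos (s := 1 / (p - 1) + (n : ℝ) / 2) (by linarith)
    have h3 := Gamma_inv_sub_one_add_one hp1 hp
    have h4 : 1 / (p - 1) + (n : ℝ) / 2 = (2 + n * (p - 1)) / (2 * (p - 1)) := by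
      field_simp
    rw [momentRatio, if_neg hp1.ne', if_neg hp1.not_gt, rpow_neg_two_div_two,
      show 1 / (p - 1) - (2 : ℕ) + 1 + ((n : ℝ) + (2 : ℕ)) / 2 = 1 / (p - 1) + (n : ℝ) / 2 by
        push_cast; ring,
      show 1 / (p - 1) - (2 : ℕ) + 1 = 1 / (p - 1) - 1 by push_cast; ring,
      show 1 / (p - 1) + 1 + (n : ℝ) / 2 = 1 / (p - 1) + (n : ℝ) / 2 + 1 by ring,
      h3, Real.Gamma_add_one (s := 1 / (p - 1) + (n : ℝ) / 2) (by linarith), mul_div_assoc _ (Gamma _),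
      div_self hΓ2.ne', h4]
    -- Naming the Gamma value keeps `field_simp` away from its argument.
    generalize Gamma (1 / (p - 1) - 1) = G at hΓ1
    field_simp
    ring

end Weights

/-! ### Score function and Fisher information -/

section Fisher

variable {n d : ℕ} {p : ℝ}

lemma weight_zero_eq_density (hnp : (n, p) ∈ labelSet)
    {D : Matrix (Fin n) (Fin n) ℝ} (hD : D.PosDef) (u z : Fin n → ℝ) :
    weight p D 0 (z - u) = density p D u z := by
  have hm := scale_pos hnp
  have hQ := PosDef.quadratic_nonneg hD (z - u)
  rcases eq_or_ne p 1 with hp1 | hp1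
  · rw [weight, density, if_pos hp1, if_pos hp1, quad, neg_mul]
  · rw [weight, density, if_neg hp1, if_neg hp1, scale, ← quad, ← base, Nat.cast_zero, sub_zero]
    rcases lt_trichotomy (base p D u z) 0 with hb | hb | hb
    · have hp : 1 < p := by
        by_contra! h
        have : 0 ≤ (1 - p) / scale n p * quad D u z :=
          mul_nonneg (div_nonneg (by linarith) hm.le) hQ
        unfold base at hb
        unfold scale at this
        linarith
      rw [posPow_of_nonpos hb.le, if_neg (by simp [dom, hp, hb]), mul_zero]
    -- On the boundary the density is `0` raised to a nonzero power, hence `0`, in agreement with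
    -- `posPow`.
    · rw [hb, posPow_of_nonpos le_rfl, if_pos (by simp [dom, hb]),
        Real.zero_rpow (one_div_ne_zero (sub_ne_zero.2 hp1))]
    · rw [posPow_of_pos hb, if_pos (by simp [dom, hb.le])]

lemma weight_eq_div_pow (D : Matrix (Fin n) (Fin n) ℝ) (j : ℕ) {w : Fin n → ℝ}
    (hb : 0 < 1 + (1 - p) / scale n p * (w ⬝ᵥ (D *ᵥ w))) :
    weight p D j w = weight p D 0 w / (1 + (1 - p) / scale n p * (w ⬝ᵥ (D *ᵥ w))) ^ j := by
  rcases eq_or_ne p 1 with hp1 | hp1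
  · subst hp1
    simp [weight]
  · simp only [weight, if_neg hp1, posPow_of_pos hb]
    rw [Real.rpow_sub_natCast hb.ne', Nat.cast_zero, sub_zero, mul_div_assoc]

lemma weight_eq_zero (D : Matrix (Fin n) (Fin n) ℝ) (j : ℕ) {w : Fin n → ℝ}
    (hb : ¬ 0 < 1 + (1 - p) / scale n p * (w ⬝ᵥ (D *ᵥ w))) :
    weight p D j w = 0 := by
  rcases eq_or_ne p 1 with hp1 | hp1
  · subst hp1
    simp at hb
  · rw [weight, if_neg hp1, posPow_of_nonpos (not_lt.1 hb), mul_zero]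

/-- Factor out `det D`: the polynomial `det (1 + t D⁻¹X)` has linear coefficient `Tr(D⁻¹X)`. -/
lemma hasDerivAt_det_add_smul {D : Matrix (Fin n) (Fin n) ℝ} (hD : D.det ≠ 0)
    (X : Matrix (Fin n) (Fin n) ℝ) :
    HasDerivAt (fun t : ℝ => (D + t • X).det) (D.det * (D⁻¹ * X).trace) 0 := by
  obtain ⟨P, hP⟩ : ∃ P : Polynomial ℝ, ∀ t : ℝ,
      (D + t • X).det = D.det * (1 + (D⁻¹ * X).trace * t + P.eval t * t ^ 2) := by
    refine ⟨(Matrix.det (1 + (Polynomial.X : Polynomial ℝ) •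
      (D⁻¹ * X).map Polynomial.C)).divX.divX, fun t => ?_⟩
    rw [← Matrix.det_one_add_smul, ← Matrix.det_mul, mul_add, mul_one, Matrix.mul_smul,
      Matrix.mul_nonsing_inv_cancel_left _ _ hD.isUnit]
  simp only [hP]
  have h2 := ((((hasDerivAt_id (0 : ℝ)).const_mul ((D⁻¹ * X).trace)).const_add 1).fun_add
    ((P.hasDerivAt 0).fun_mul (hasDerivAt_pow 2 (0 : ℝ)))).const_mul D.det
  refine h2.congr_deriv ?_
  simp

/-- The form is a cubic polynomial in `t`; the derivative is its linear coefficient. -/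
lemma hasDerivAt_quad_alongLine {D : Matrix (Fin n) (Fin n) ℝ} (hD : D.IsSymm)
    (X : Matrix (Fin n) (Fin n) ℝ) (u x z : Fin n → ℝ) :
    HasDerivAt (fun t : ℝ => quad (D + t • X) (u + t • x) z)
      ((z - u) ⬝ᵥ (X *ᵥ (z - u)) - 2 * ((D *ᵥ x) ⬝ᵥ (z - u))) 0 := by
  have h1 : ∀ t : ℝ, quad (D + t • X) (u + t • x) z =
      quad D u z + t * ((z - u) ⬝ᵥ (X *ᵥ (z - u)) - 2 * ((D *ᵥ x) ⬝ᵥ (z - u))) +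
        t ^ 2 * (x ⬝ᵥ (D *ᵥ x) - x ⬝ᵥ (X *ᵥ (z - u)) - (z - u) ⬝ᵥ (X *ᵥ x)) +
        t ^ 3 * (x ⬝ᵥ (X *ᵥ x)) := by
    intro t
    have h2 : x ⬝ᵥ (D *ᵥ (z - u)) = (D *ᵥ x) ⬝ᵥ (z - u) := by
      rw [Matrix.dotProduct_mulVec, ← Matrix.mulVec_transpose, hD.eq]
    have h3 : (z - u) ⬝ᵥ (D *ᵥ x) = (D *ᵥ x) ⬝ᵥ (z - u) := dotProduct_comm _ _
    rw [quad, quad, ← sub_sub]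
    generalize z - u = w at h2 h3 ⊢
    simp only [Matrix.add_mulVec, Matrix.smul_mulVec, Matrix.mulVec_sub, Matrix.mulVec_smul,
      sub_dotProduct, dotProduct_sub, dotProduct_add, smul_dotProduct, dotProduct_smul,
      smul_eq_mul, h2, h3]
    ring
  simp only [h1]
  have h2 := ((((hasDerivAt_id (0 : ℝ)).mul_const ((z - u) ⬝ᵥ (X *ᵥ (z - u)) -
    2 * ((D *ᵥ x) ⬝ᵥ (z - u)))).const_add (quad D u z)).fun_add ((hasDerivAt_pow 2 (0 : ℝ)).mul_const
      (x ⬝ᵥ (D *ᵥ x) - x ⬝ᵥ (X *ᵥ (z - u)) - (z - u) ⬝ᵥ (X *ᵥ x)))).fun_add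
    ((hasDerivAt_pow 3 (0 : ℝ)).mul_const (x ⬝ᵥ (X *ᵥ x)))
  refine h2.congr_deriv ?_
  simp

/-- The logarithmic derivative of the density along a tangent vector. -/
lemma hasDerivAt_log_density (hnp : (n, p) ∈ labelSet) {D : Matrix (Fin n) (Fin n) ℝ}
    (hD : D.PosDef) (X : Matrix (Fin n) (Fin n) ℝ) (u x z : Fin n → ℝ)
    (hb : 0 < base p D u z) :
    HasDerivAt (alongLine (fun D' u' => Real.log (density p D' u' z)) D u X x)
      (1 / 2 * (D⁻¹ * X).trace - 1 / scale n p * (((z - u) ⬝ᵥ (X *ᵥ (z - u)) -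
        2 * ((D *ᵥ x) ⬝ᵥ (z - u))) / base p D u z)) 0 := by
  have hm := scale_pos hnp
  have hdet := hD.det_pos
  have hq := hasDerivAt_quad_alongLine (D := D) (by simpa using hD.isHermitian) X u x z
  have hd := hasDerivAt_det_add_smul hdet.ne' X
  have hdet_ev : ∀ᶠ t in nhds (0 : ℝ), 0 < (D + t • X).det :=
    hd.continuousAt.eventually_const_lt (by simpa using hdet)
  have hld : HasDerivAt (fun t : ℝ => 1 / 2 * Real.log (D + t • X).det)
      (1 / 2 * (D⁻¹ * X).trace) 0 := by
    refine ((hd.log (by simpa using hdet.ne')).const_mul (1 / 2)).congr_deriv ?_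
    simp only [zero_smul, add_zero]
    field_simp
  rcases eq_or_ne p 1 with hp1 | hp1
  · subst hp1
    have hev : alongLine (fun D' u' => Real.log (density 1 D' u' z)) D u X x =ᶠ[nhds 0]
        fun t => -Real.log √((2 * π) ^ n) + 1 / 2 * Real.log (D + t • X).det +
          -(1 / 2) * quad (D + t • X) (u + t • x) z := by
      filter_upwards [hdet_ev] with t ht
      have h1 : 0 < √((2 * π) ^ n) := by positivity
      have h2 : 0 < √(D + t • X).det := Real.sqrt_pos.2 ht
      rw [alongLine, density, if_pos rfl, Real.log_mul (by positivity) (by positivity),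
        Real.log_div h2.ne' h1.ne', Real.log_exp, Real.log_sqrt ht.le]
      ring
    refine (((hld.const_add _).fun_add (hq.const_mul (-(1 / 2)))).congr_of_eventuallyEq
      hev).congr_deriv ?_
    -- At `p = 1`, `scale` is `2` and `base` is `1`, so the general formula is the Gaussian score.
    simp [scale, base]
    ring
  · have hbt : HasDerivAt (fun t : ℝ => base p (D + t • X) (u + t • x) z)
        ((1 - p) / scale n p *
          ((z - u) ⬝ᵥ (X *ᵥ (z - u)) - 2 * ((D *ᵥ x) ⬝ᵥ (z - u)))) 0 :=
      (hq.const_mul _).const_add 1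
    have hb_ev : ∀ᶠ t in nhds (0 : ℝ), 0 < base p (D + t • X) (u + t • x) z :=
      hbt.continuousAt.eventually_const_lt (by simpa using hb)
    have hev : alongLine (fun D' u' => Real.log (density p D' u' z)) D u X x =ᶠ[nhds 0]
        fun t => Real.log (normConst n p) + 1 / 2 * Real.log (D + t • X).det +
          1 / (p - 1) * Real.log (base p (D + t • X) (u + t • x) z) := by
      filter_upwards [hdet_ev, hb_ev] with t ht hbt
      have h1 := normConst_pos hnp hp1
      have h2 : 0 < √(D + t • X).det := Real.sqrt_pos.2 ht
      rw [alongLine, density, if_neg hp1, if_pos (by simp [dom, hbt.le]),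
        Real.log_mul (by positivity) (by positivity), Real.log_mul h1.ne' h2.ne',
        Real.log_sqrt ht.le, Real.log_rpow hbt]
      ring
    refine (((hld.const_add _).fun_add ((hbt.log (by simpa using hb.ne')).const_mul
      (1 / (p - 1)))).congr_of_eventuallyEq hev).congr_deriv ?_
    have h1 : p - 1 ≠ 0 := sub_ne_zero.2 hp1
    simp only [zero_smul, add_zero]
    field_simp
    ring

lemma base_pos_of_density_pos (hnp : (n, p) ∈ labelSet) {D : Matrix (Fin n) (Fin n) ℝ}
    (hD : D.PosDef) {u z : Fin n → ℝ} (h : 0 < density p D u z) : 0 < base p D u z := by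
  by_contra hb
  rw [← weight_zero_eq_density hnp hD, weight_eq_zero D 0 hb] at h
  exact h.false

lemma fisherIntegrand_eq (hnp : (n, p) ∈ labelSet) {D : Matrix (Fin n) (Fin n) ℝ}
    (hD : D.PosDef) (X Y : Matrix (Fin n) (Fin n) ℝ) (u x y z : Fin n → ℝ) :
    fisherIntegrand (density p) D u X x Y y z =
      (1 / 2 * (D⁻¹ * X).trace) * (1 / 2 * (D⁻¹ * Y).trace) * weight p D 0 (z - u) -
      1 / scale n p * (1 / 2 * (D⁻¹ * X).trace *
          ((z - u) ⬝ᵥ (Y *ᵥ (z - u)) - 2 * ((D *ᵥ y) ⬝ᵥ (z - u))) +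
        1 / 2 * (D⁻¹ * Y).trace *
          ((z - u) ⬝ᵥ (X *ᵥ (z - u)) - 2 * ((D *ᵥ x) ⬝ᵥ (z - u)))) * weight p D 1 (z - u) +
      (1 / scale n p) ^ 2 * (((z - u) ⬝ᵥ (X *ᵥ (z - u)) - 2 * ((D *ᵥ x) ⬝ᵥ (z - u))) *
        ((z - u) ⬝ᵥ (Y *ᵥ (z - u)) - 2 * ((D *ᵥ y) ⬝ᵥ (z - u)))) * weight p D 2 (z - u) := by
  unfold fisherIntegrand
  rw [← weight_zero_eq_density hnp hD]
  by_cases hb : 0 < base p D u z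
  · rw [tangentDeriv, tangentDeriv, (hasDerivAt_log_density hnp hD X u x z hb).deriv,
      (hasDerivAt_log_density hnp hD Y u y z hb).deriv, weight_eq_div_pow D 1 hb,
      weight_eq_div_pow D 2 hb]
    change _ = _ - _ * (_ / base p D u z ^ 1) + _ * (_ / base p D u z ^ 2)
    field_simp
    ring
  -- Off the support all weights vanish, whatever values the derivatives take.
  · simp only [weight_eq_zero D _ hb]
    ring

lemma Homog.integral_mul_weight_of_gaussMoment (hnp : (n, p) ∈ labelSet) (hp : p < 2)
    {D : Matrix (Fin n) (Fin n) ℝ} (hD : D.PosDef) {h : (Fin n → ℝ) → ℝ} (hh : Homog d h)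
    {j : ℕ} (hdj : d ≤ 2 * j) (hj : j ≤ 2) {v : ℝ}
    (hv : gaussMoment D h = v * gaussMoment D (fun _ => 1)) :
    Integrable (fun w => h w * weight p D j w) ∧
    ∫ w, h w * weight p D j w = momentRatio n p d j * v := by
  obtain ⟨hi, he⟩ := hh.integral_mul_weight hnp hp hD hdj hj
  refine ⟨hi, ?_⟩
  have hG := gaussMoment_one_pos hD
  rw [hv, ← mul_assoc, mul_comm (gaussMoment D _)] at he
  exact mul_right_cancel₀ hG.ne' he

/-- Fisher information of the `p`-Gaussian family, with absolute convergence. -/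
lemma integral_fisherIntegrand (hnp : (n, p) ∈ labelSet) (hp : p < 2)
    {D : Matrix (Fin n) (Fin n) ℝ} (hD : D.PosDef) (X : Matrix (Fin n) (Fin n) ℝ)
    {Y : Matrix (Fin n) (Fin n) ℝ} (hY : Y.IsSymm) (u x y : Fin n → ℝ) :
    Integrable (fisherIntegrand (density p) D u X x Y y) ∧
    ∫ z, fisherIntegrand (density p) D u X x Y y z =
      1 / (2 * (2 - p)) * (D⁻¹ * X * D⁻¹ * Y).trace +
      (p - 1) / (4 * (2 - p)) * ((D⁻¹ * X).trace * (D⁻¹ * Y).trace) +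
      (2 + (n : ℝ) * (p - 1)) / ((2 * p + (n : ℝ) * (p - 1)) * (2 - p)) *
        (x ⬝ᵥ (D *ᵥ y)) := by
  have hqX := Homog.quadratic X
  have hqY := Homog.quadratic Y
  have hlx := Homog.linear (D *ᵥ x)
  have hly := Homog.linear (D *ᵥ y)
  -- Nine homogeneous pieces arise from expanding the product of scores; those of odd degree
  -- integrate to zero.
  obtain ⟨i1, e1⟩ := (Homog.const (n := n) 1).integral_mul_weight_of_gaussMoment hnp hp hD
    (j := 0) (v := 1) (by norm_num) (by norm_num) (by simp)
  obtain ⟨i2, e2⟩ := hqX.integral_mul_weight_of_gaussMoment hnp hp hD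
    (j := 1) (by norm_num) (by norm_num) (gaussMoment_quadratic hD X)
  obtain ⟨i3, e3⟩ := hqY.integral_mul_weight_of_gaussMoment hnp hp hD
    (j := 1) (by norm_num) (by norm_num) (gaussMoment_quadratic hD Y)
  obtain ⟨i4, e4⟩ := hlx.integral_mul_weight_of_gaussMoment hnp hp hD (v := 0)
    (j := 1) (by norm_num) (by norm_num)
    (by rw [zero_mul]; exact gaussMoment_of_odd D fun w => by simp)
  obtain ⟨i5, e5⟩ := hly.integral_mul_weight_of_gaussMoment hnp hp hD (v := 0)
    (j := 1) (by norm_num) (by norm_num)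
    (by rw [zero_mul]; exact gaussMoment_of_odd D fun w => by simp)
  obtain ⟨i6, e6⟩ := (hqX.mul hqY).integral_mul_weight_of_gaussMoment hnp hp hD
    (j := 2) (by norm_num) (by norm_num) (gaussMoment_quadratic_mul_quadratic hD X hY)
  obtain ⟨i7, e7⟩ := (hqX.mul hly).integral_mul_weight_of_gaussMoment hnp hp hD (v := 0)
    (j := 2) (by norm_num) (by norm_num)
    (by rw [zero_mul]; exact gaussMoment_of_odd D fun w => by simp [Matrix.mulVec_neg])
  obtain ⟨i8, e8⟩ := (hlx.mul hqY).integral_mul_weight_of_gaussMoment hnp hp hD (v := 0)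
    (j := 2) (by norm_num) (by norm_num)
    (by rw [zero_mul]; exact gaussMoment_of_odd D fun w => by simp [Matrix.mulVec_neg])
  obtain ⟨i9, e9⟩ := (hlx.mul hly).integral_mul_weight_of_gaussMoment hnp hp hD
    (j := 2) (by norm_num) (by norm_num) (gaussMoment_linear_mul_linear hD x y)
  have hm := scale_pos hnp
  have h2p : 0 < 2 - p := by linarith
  set a := 1 / 2 * (D⁻¹ * X).trace with ha
  set b := 1 / 2 * (D⁻¹ * Y).trace with hb
  set r := 1 / scale n p with hr
  have j2 := i2.const_mul (-(r * b))
  have j3 := i3.const_mul (-(r * a))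
  have j4 := i4.const_mul (2 * r * b)
  have j5 := i5.const_mul (2 * r * a)
  have j6 := i6.const_mul (r ^ 2)
  have j7 := i7.const_mul (-(2 * r ^ 2))
  have j8 := i8.const_mul (-(2 * r ^ 2))
  have j9 := i9.const_mul (4 * r ^ 2)
  have j1 := i1.const_mul (a * b)
  have k2 := j1.fun_add j2
  have k3 := k2.fun_add j3
  have k4 := k3.fun_add j4
  have k5 := k4.fun_add j5
  have k6 := k5.fun_add j6
  have k7 := k6.fun_add j7
  have k8 := k7.fun_add j8
  have k9 := k8.fun_add j9
  have hval := integral_add k8 j9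
  rw [integral_add k7 j8, integral_add k6 j7, integral_add k5 j6, integral_add k4 j5,
    integral_add k3 j4, integral_add k2 j3, integral_add j1 j2] at hval
  simp only [integral_const_mul, e1, e2, e3, e4, e5, e6, e7, e8, e9] at hval
  rw [← integral_sub_right_eq_self _ u] at hval
  have k := k9.comp_sub_right u
  have hfun : ∀ z, fisherIntegrand (density p) D u X x Y y z = _ :=
    fun z => fisherIntegrand_eq hnp hD X Y u x y z
  constructor
  · refine k.congr (ae_of_all _ fun z => ?_)
    simp only [hfun, ← ha, ← hb, ← hr]
    ring
  · refine (integral_congr_ae (ae_of_all _ fun z => ?_)).trans (hval.trans ?_)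
    · simp only [hfun, ← ha, ← hb, ← hr]
      ring
    · norm_num only [mul_zero, add_zero]
      -- The coefficient of `Tr(D⁻¹X) Tr(D⁻¹Y)` is `1/4 - 1/2 + 1/(4(2-p)) = (p-1)/(4(2-p))`.
      rw [momentRatio_zero_zero hnp hp, momentRatio_two_one hnp hp, momentRatio_two_two hnp hp,
        momentRatio_four_two hnp hp, ha, hb, hr,
        show 2 * p + (n : ℝ) * (p - 1) = scale n p by unfold scale; ring]
      field_simp
      ring

end Fisher

end PGaussian

end

theorem mainTheorem4 (n : ℕ) (p : ℝ) (hnp : (n, p) ∈ PGaussian.labelSet) (hp : p < 2)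
    (D : Matrix (Fin n) (Fin n) ℝ) (hD : D.PosDef) (u : Fin n → ℝ)
    (X : Matrix (Fin n) (Fin n) ℝ) (hX : X.IsSymm) (x : Fin n → ℝ)
    (Y : Matrix (Fin n) (Fin n) ℝ) (hY : Y.IsSymm) (y : Fin n → ℝ) :
    (∀ z : Fin n → ℝ, 0 < PGaussian.density p D u z →
      DifferentiableAt ℝ (PGaussian.alongLine
        (fun D' u' => Real.log (PGaussian.density p D' u' z)) D u X x) 0 ∧
      DifferentiableAt ℝ (PGaussian.alongLine
        (fun D' u' => Real.log (PGaussian.density p D' u' z)) D u Y y) 0) ∧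
    MeasureTheory.Integrable
      (PGaussian.fisherIntegrand (PGaussian.density p) D u X x Y y) ∧
    PGaussian.fisherInformation (PGaussian.density p) D u X x Y y =
      1 / (2 * (2 - p)) * (D⁻¹ * X * D⁻¹ * Y).trace +
      (p - 1) / (4 * (2 - p)) * ((D⁻¹ * X).trace * (D⁻¹ * Y).trace) +
      (2 + (n : ℝ) * (p - 1)) / ((2 * p + (n : ℝ) * (p - 1)) * (2 - p)) *
        (x ⬝ᵥ (D *ᵥ y)) := by
  refine ⟨fun z hz => ?_, PGaussian.integral_fisherIntegrand hnp hp hD X hY u x y⟩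
  have hb := PGaussian.base_pos_of_density_pos hnp hD hz
  exact ⟨(PGaussian.hasDerivAt_log_density hnp hD X u x z hb).differentiableAt,
    (PGaussian.hasDerivAt_log_density hnp hD Y u y z hb).differentiableAt⟩
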